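/- **Problem.** Let $M\in\mathbb N$ and block sizes $n_i,m_i,p_i$ ($1\le i\le M$) be given; put $n=\sum_i n_i$, $m=\sum_i m_i$, $p=\sum_i p_i$. Consider $$\text{minimize } \sum_{i=1}^M\{f_i(x_i)+h_i(x_i)\}+\sum_{i=1}^M g_i\big((Bx)_i\big)\quad\text{subject to } Ax=b,$$ with $x=(x_1,\dots,x_M)$, $x_i\in\mathbb R^{n_i}$, $A=(A_{ij})\in\mathbb R^{m\times n}$, $A_{ij}\in\mathbb R^{m_i\times n_j}$, $B=(B_{ij})\in\mathbb R^{p\times n}$, $B_{ij}\in\mathbb R^{p_i\times n_j}$, $b=(b_1,\dots,b_M)$, $b_i\in\mathbb R^{m_i}$. Write $\|x\|_L^2=x^TLx$. Assume: (a) each $f_i:\mathbb R^{n_i}\to\mathbb R$ is differentiable and strongly convex with a symmetric positive definite matrix $H_i$, i.e. $f_i(x)\ge f_i(y)+\langle\nabla f_i(y),x-y\rangle+\frac12\|x-y\|_{H_i}^2$ for all $x,y$; (b) $h_i:\mathbb R^{n_i}\to\mathbb R\cup\{\infty\}$ and $g_i:\mathbb R^{p_i}\to\mathbb R\cup\{\infty\}$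 are proper, closed and convex; (c) $A$ has full row rank. Let $H=\operatorname{blkdiag}(H_1,\dots,H_M)$, $F(x)=\sum_i\{f_i(x_i)+h_i(x_i)\}$, $g(y)=\sum_i g_i(y_i)$, $C=[A^T\ B^T]^T$, $c=(b,0)$, and for $\nu=(\lambda,\mu)\in\mathbb R^{m}\times\mathbb R^{p}$ $$d(\nu)=-F^\star(-C^T\nu)-c^T\nu,\qquad \widetilde g(\nu)=g^\star(\mu),\qquad D=d-\widetilde g,$$ where $\varphi^\star(y)=\sup_x\{y^Tx-\varphi(x)\}$. Let $\mathcal N_i=\{j: A_{ij}\ne0\text{ or }B_{ij}\neq 0\}$, $\mathcal M_i=\{j: A_{ji}\ne0\text{ or }B_{ji}\ne0\}$, and $\operatorname{prox}_\psi^{L}(x)=\arg\min_y\{\psi(y)+\frac12\|y-x\|_L^2\}$. In both methods $t^1=1$ and $t^{k+1}=\frac{1+\sqrt{1+4(t^k)^2}}2$. **Distributed method.** Given symmetric positive definite $L_{\lambda i}\in\mathbb R^{m_i\times m_i}$, $L_{\mu i}\in\mathbb R^{p_i\times p_i}$ and arbitrary $(\lambda^0,\mu^0)$, set $z^1=\lambda^0$,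 $v^1=\mu^0$ and, for $k\ge1$ and all $i$, $$y_i^k=\arg\min_{x_i}\Big\{f_i(x_i)+h_i(x_i)+x_i^T\Big(\sum_{j\in\mathcal M_i}A_{ji}^Tz_j^k+\sum_{j\in\mathcal M_i}B_{ji}^Tv_j^k\Big)\Big\},$$ $$\lambda_i^k=z_i^k+L_{\lambda i}^{-1}\Big(\sum_{j\in\mathcal N_i}A_{ij}y_j^k-b_i\Big),\qquad \mu_i^k=\operatorname{prox}_{g_i^\star}^{L_{\mu i}}\Big(v_i^k+L_{\mu i}^{-1}\sum_{j\in\mathcal N_i}B_{ij}y_j^k\Big),$$ $$z_i^{k+1}=\lambda_i^k+\tfrac{t^k-1}{t^{k+1}}(\lambda_i^k-\lambda_i^{k-1}),\qquad v_i^{k+1}=\mu_i^k+\tfrac{t^k-1}{t^{k+1}}(\mu_i^k-\mu_i^{k-1}).$$ Put $\nu^k=(\lambda^k,\mu^k)$ for $k\ge0$ and $\mathbf L=\operatorname{blkdiag}(L_{\lambda1},\dots,L_{\lambda M},L_{\mu1},\dots,L_{\mu M})$. **Parallel method** (for problems with all $g_i=0$). Given a symmetric positive definite $\mathbf L\in\mathbb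 R^{m\times m}$ and an arbitrary $\lambda^0$, set $z^1=\lambda^0$ and, for $k\ge1$, $$y_i^k=\arg\min_{x_i}\Big\{f_i(x_i)+h_i(x_i)+x_i^T\sum_{j\in\mathcal M_i}A_{ji}^Tz_j^k\Big\}\ (1\le i\le M),\qquad \lambda^k=z^k+\mathbf L^{-1}(Ay^k-b),$$ $$z^{k+1}=\lambda^k+\tfrac{t^k-1}{t^{k+1}}(\lambda^k-\lambda^{k-1}).$$ Here $\widetilde g(\lambda,\mu)$ is $0$ if $\mu=0$ and $\infty$ otherwise (if $p=0$, the variable $\mu$ is absent), and we put $\nu^k=(\lambda^k,0)$. **Proposition.** Both methods are well defined (from every starting point all the minimization problems in the iteration have solutions). Let $\nu^\star=(\lambda^\star,\mu^\star)$ be any maximizer of $D$. 1. If $\mathbf L\succeq CH^{-1}C^T$, then the distributed method satisfies $$D(\nu^\star)-D(\nu^k)\le\frac{2\|\nu^\star-\nu^0\|_{\mathbf L}^2}{(k+1)^2}\qquad\text{for all }k\ge1.$$ 2. If all $g_i=0$ and $\mathbf L\succeq AH^{-1}A^T$, then the parallel method satisfies $$D(\nu^\star)-D(\nu^k)\le\frac{2\|\lambda^\star-\lambda^0\|_{\mathbf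 L}^2}{(k+1)^2}\qquad\text{for all }k\ge1.$$ -/

import Mathlib

open scoped Matrix

noncomputable section

/-! ### Convex-analytic notions -/

/-- The squared weighted norm `‖x‖_L² = xᵀ L x`. -/
def normSq {ι : Type*} [Fintype ι] (L : Matrix ι ι ℝ) (x : ι → ℝ) : ℝ :=
  x ⬝ᵥ (L *ᵥ x)

/-- A differentiable `f : ℝⁿ → ℝ` is strongly convex with the (symmetric positive definite) matrix
`H` if `f x₁ ≥ f x₂ + ⟨∇f x₂, x₁ - x₂⟩ + ½ ‖x₁ - x₂‖_H²` for all `x₁, x₂`.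
Here `⟨∇f x₂, x₁ - x₂⟩` is the derivative of `f` at `x₂` applied to `x₁ - x₂`. -/
structure StronglyConvexWith {ι : Type*} [Fintype ι] (f : (ι → ℝ) → ℝ) (H : Matrix ι ι ℝ) :
    Prop where
  posDef : H.PosDef
  differentiable : Differentiable ℝ f
  lower_bound : ∀ x₁ x₂ : ι → ℝ,
    f x₁ ≥ f x₂ + fderiv ℝ f x₂ (x₁ - x₂) + 1 / 2 * normSq H (x₁ - x₂)

/-- Proper, closed (lower semicontinuous) and convex (convex epigraph) extended-valued functions
`ℝⁿ → ℝ ∪ {∞}`. -/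
structure ProperClosedConvex {ι : Type*} (h : (ι → ℝ) → EReal) : Prop where
  ne_bot : ∀ x, h x ≠ ⊥
  exists_ne_top : ∃ x, h x ≠ ⊤
  closed : LowerSemicontinuous h
  convex : Convex ℝ {q : (ι → ℝ) × ℝ | h q.1 ≤ (q.2 : EReal)}

/-- The conjugate function `φ⋆(y) = sup_x {yᵀ x - φ(x)}`. -/
def conj {ι : Type*} [Fintype ι] (φ : (ι → ℝ) → EReal) (y : ι → ℝ) : EReal :=
  ⨆ x : ι → ℝ, ((y ⬝ᵥ x : ℝ) : EReal) - φ x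

/-- `x` is a minimizer of `φ` over the whole space. -/
def IsArgmin {E : Type*} (φ : E → EReal) (x : E) : Prop := ∀ y, φ x ≤ φ y

/-- `x` is a maximizer of `φ` over the whole space. -/
def IsArgmax {E : Type*} (φ : E → EReal) (x : E) : Prop := ∀ y, φ y ≤ φ x

/-- `y = prox_ψ^L(x) = argmin_y {ψ(y) + ½ ‖y - x‖_L²}`. -/
def IsProx {ι : Type*} [Fintype ι] (ψ : (ι → ℝ) → EReal) (L : Matrix ι ι ℝ) (x y : ι → ℝ) : Prop :=
  IsArgmin (fun w => ψ w + ((1 / 2 * normSq L (w - x) : ℝ) : EReal)) y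

/-! ### The structured optimization problem -/

/-- The index set of a stacked vector `(w_1, …, w_M)` with `w_i ∈ ℝ^{s i}`. -/
abbrev BlockIdx {M : ℕ} (s : Fin M → ℕ) : Type := Σ i : Fin M, Fin (s i)

/-- The stacked vector `(w_1, …, w_M)`. -/
def stack {M : ℕ} {s : Fin M → ℕ} (w : ∀ i, Fin (s i) → ℝ) : BlockIdx s → ℝ :=
  fun a => w a.1 a.2

/-- The `i`-th block of a stacked vector. -/
def block {M : ℕ} {s : Fin M → ℕ} (w : BlockIdx s → ℝ) (i : Fin M) : Fin (s i) → ℝ :=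
  fun a => w ⟨i, a⟩

/-- Data of the problem: minimize `f(x) + h(x) + g(Bx)` subject to `Ax = b`, where
`f(x) = ∑ f_i(x_i)`, `h(x) = ∑ h_i(x_i)`, `g(y) = ∑ g_i(y_i)`, and `A`, `B`, `b` are given by
their blocks `A_ij`, `B_ij`, `b_i`. -/
structure Problem (M : ℕ) (n m p : Fin M → ℕ) where
  f : ∀ i, (Fin (n i) → ℝ) → ℝ
  h : ∀ i, (Fin (n i) → ℝ) → EReal
  g : ∀ i, (Fin (p i) → ℝ) → EReal
  A : ∀ i j, Matrix (Fin (m i)) (Fin (n j)) ℝ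
  B : ∀ i j, Matrix (Fin (p i)) (Fin (n j)) ℝ
  b : ∀ i, Fin (m i) → ℝ

namespace Problem

variable {M : ℕ} {n m p : Fin M → ℕ} (P : Problem M n m p)

/-- The full matrix `A`. -/
def fullA : Matrix (BlockIdx m) (BlockIdx n) ℝ := Matrix.of fun r c => P.A r.1 c.1 r.2 c.2

/-- The full matrix `B`. -/
def fullB : Matrix (BlockIdx p) (BlockIdx n) ℝ := Matrix.of fun r c => P.B r.1 c.1 r.2 c.2

/-- `C = [Aᵀ Bᵀ]ᵀ`. -/
def fullC : Matrix (BlockIdx m ⊕ BlockIdx p) (BlockIdx n) ℝ := Matrix.fromRows P.fullA P.fullB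

/-- `c = (b, 0)`. -/
def fullc : BlockIdx m ⊕ BlockIdx p → ℝ := Sum.elim (stack P.b) 0

/-- `F(x) = f(x) + h(x) = ∑ f_i(x_i) + ∑ h_i(x_i)`. -/
def F (x : BlockIdx n → ℝ) : EReal :=
  ((∑ i, P.f i (block x i) : ℝ) : EReal) + ∑ i, P.h i (block x i)

/-- `g(y) = ∑ g_i(y_i)`. -/
def fullg (y : BlockIdx p → ℝ) : EReal := ∑ i, P.g i (block y i)

/-- `d(ν) = -F⋆(-Cᵀ ν) - cᵀ ν`. -/
def d (ν : BlockIdx m ⊕ BlockIdx p → ℝ) : EReal :=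
  -conj P.F (-(P.fullCᵀ *ᵥ ν)) - ((P.fullc ⬝ᵥ ν : ℝ) : EReal)

/-- `g̃(ν) = g⋆([0 I] ν)`, i.e. `g̃(λ, μ) = g⋆(μ)`. -/
def gTilde (ν : BlockIdx m ⊕ BlockIdx p → ℝ) : EReal := conj P.fullg (fun a => ν (Sum.inr a))

/-- The dual objective `D = d - g̃`. -/
def D (ν : BlockIdx m ⊕ BlockIdx p → ℝ) : EReal := P.d ν - P.gTilde ν

open Classical in
/-- `𝒩_i`: the indices of the nonzero blocks in block row `i` of `A` and `B`. -/
def rowNbrs (i : Fin M) : Finset (Fin M) := {j | P.A i j ≠ 0 ∨ P.B i j ≠ 0}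

open Classical in
/-- `ℳ_i`: the indices of the nonzero blocks in block column `i` of `A` and `B`. -/
def colNbrs (i : Fin M) : Finset (Fin M) := {j | P.A j i ≠ 0 ∨ P.B j i ≠ 0}

/-- The standing assumptions on the problem, with strong convexity matrices `H_i`. -/
structure Assumptions (H : ∀ i, Matrix (Fin (n i)) (Fin (n i)) ℝ) : Prop where
  f_strong : ∀ i, StronglyConvexWith (P.f i) (H i)
  h_pcc : ∀ i, ProperClosedConvex (P.h i)
  g_pcc : ∀ i, ProperClosedConvex (P.g i)
  fullRowRank : LinearIndependent ℝ P.fullA.row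

end Problem

/-! ### The algorithms -/

/-- The sequences produced by the distributed method; the index is the iteration number, and the
second argument of the vector sequences is the node. -/
structure DistIterates {M : ℕ} (n m p : Fin M → ℕ) where
  y : ℕ → ∀ i, Fin (n i) → ℝ
  z : ℕ → ∀ i, Fin (m i) → ℝ
  v : ℕ → ∀ i, Fin (p i) → ℝ
  lam : ℕ → ∀ i, Fin (m i) → ℝ
  mu : ℕ → ∀ i, Fin (p i) → ℝ
  t : ℕ → ℝ

/-- `S` is a run of the distributed generalized fast dual gradient method with matrices
`L_{λ i}`, `L_{μ i}`, started at `(λ⁰, μ⁰)`. The products `A_{ℳ_i}ᵀ z_{ℳ_i}`, `A_{𝒩_i} y_{𝒩_i}` of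
concatenated blocks are written as sums over `ℳ_i`, `𝒩_i`. (The entries with index `0` of
`y, z, v, t` are not part of the algorithm.) -/
structure IsDistRun {M : ℕ} {n m p : Fin M → ℕ} (P : Problem M n m p)
    (Llam : ∀ i, Matrix (Fin (m i)) (Fin (m i)) ℝ) (Lmu : ∀ i, Matrix (Fin (p i)) (Fin (p i)) ℝ)
    (lam0 : ∀ i, Fin (m i) → ℝ) (mu0 : ∀ i, Fin (p i) → ℝ) (S : DistIterates n m p) : Prop where
  lam_zero : S.lam 0 = lam0
  mu_zero : S.mu 0 = mu0
  z_one : S.z 1 = lam0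
  v_one : S.v 1 = mu0
  t_one : S.t 1 = 1
  y_step : ∀ k, 1 ≤ k → ∀ i,
    IsArgmin (fun x : Fin (n i) → ℝ => (P.f i x : EReal) + P.h i x +
      ((x ⬝ᵥ (∑ j ∈ P.colNbrs i, (P.A j i)ᵀ *ᵥ S.z k j +
        ∑ j ∈ P.colNbrs i, (P.B j i)ᵀ *ᵥ S.v k j) : ℝ) : EReal)) (S.y k i)
  lam_step : ∀ k, 1 ≤ k → ∀ i,
    S.lam k i = S.z k i + (Llam i)⁻¹ *ᵥ (∑ j ∈ P.rowNbrs i, P.A i j *ᵥ S.y k j - P.b i)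
  mu_step : ∀ k, 1 ≤ k → ∀ i,
    IsProx (conj (P.g i)) (Lmu i)
      (S.v k i + (Lmu i)⁻¹ *ᵥ ∑ j ∈ P.rowNbrs i, P.B i j *ᵥ S.y k j) (S.mu k i)
  t_step : ∀ k, 1 ≤ k → S.t (k + 1) = (1 + √(1 + 4 * S.t k ^ 2)) / 2
  z_step : ∀ k, 1 ≤ k → ∀ i,
    S.z (k + 1) i = S.lam k i + ((S.t k - 1) / S.t (k + 1)) • (S.lam k i - S.lam (k - 1) i)
  v_step : ∀ k, 1 ≤ k → ∀ i,
    S.v (k + 1) i = S.mu k i + ((S.t k - 1) / S.t (k + 1)) • (S.mu k i - S.mu (k - 1) i)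

/-- The sequences produced by the parallel method. -/
structure ParIterates {M : ℕ} (n m : Fin M → ℕ) where
  y : ℕ → ∀ i, Fin (n i) → ℝ
  z : ℕ → BlockIdx m → ℝ
  lam : ℕ → BlockIdx m → ℝ
  t : ℕ → ℝ

/-- `S` is a run of the parallel generalized fast dual gradient method with matrix `L`, started at
`λ⁰`: parallel primal updates, central dual update. -/
structure IsParRun {M : ℕ} {n m p : Fin M → ℕ} (P : Problem M n m p)
    (L : Matrix (BlockIdx m) (BlockIdx m) ℝ) (lam0 : BlockIdx m → ℝ) (S : ParIterates n m) :
    Prop where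
  lam_zero : S.lam 0 = lam0
  z_one : S.z 1 = lam0
  t_one : S.t 1 = 1
  y_step : ∀ k, 1 ≤ k → ∀ i,
    IsArgmin (fun x : Fin (n i) → ℝ => (P.f i x : EReal) + P.h i x +
      ((x ⬝ᵥ (∑ j ∈ P.colNbrs i, (P.A j i)ᵀ *ᵥ block (S.z k) j) : ℝ) : EReal)) (S.y k i)
  lam_step : ∀ k, 1 ≤ k →
    S.lam k = S.z k + L⁻¹ *ᵥ (P.fullA *ᵥ stack (S.y k) - stack P.b)
  t_step : ∀ k, 1 ≤ k → S.t (k + 1) = (1 + √(1 + 4 * S.t k ^ 2)) / 2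
  z_step : ∀ k, 1 ≤ k →
    S.z (k + 1) = S.lam k + ((S.t k - 1) / S.t (k + 1)) • (S.lam k - S.lam (k - 1))

/-- `L = blkdiag(L_λ, L_μ)` with `L_λ = blkdiag(L_{λ 1}, …, L_{λ M})` and
`L_μ = blkdiag(L_{μ 1}, …, L_{μ M})`. -/
def distL {M : ℕ} {m p : Fin M → ℕ} (Llam : ∀ i, Matrix (Fin (m i)) (Fin (m i)) ℝ)
    (Lmu : ∀ i, Matrix (Fin (p i)) (Fin (p i)) ℝ) :
    Matrix (BlockIdx m ⊕ BlockIdx p) (BlockIdx m ⊕ BlockIdx p) ℝ :=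
  Matrix.fromBlocks (Matrix.blockDiagonal' Llam) 0 0 (Matrix.blockDiagonal' Lmu)

end

open scoped Matrix

/-! ### Weighted quadratic forms. -/

section NormSq

variable {ι : Type*} [Fintype ι] {L : Matrix ι ι ℝ}

/-! Both methods are accelerated proximal gradient ascent on `D = d - g̃` in the metric of `L`. Let
`y` minimize the Lagrangian at `z`, and put `ℓ(w) = F(y) + w ⬝ᵥ (C y - c)`. Testing the conjugate
with `y` gives `d ≤ ℓ`. Quadratic growth of the Lagrangian around `y`, with modulus `H`, and Young's
inequality give `d(w) ≥ ℓ(w) - ½‖w - z‖²` in the seminorm of `C H⁻¹ Cᵀ` (`dual_bounds`). This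
replaces any appeal to the gradient of `d`.

The dual update maximizes `ℓ - g̃ - ½‖· - z‖_L²`. Its own quadratic growth and `L ⪰ C H⁻¹ Cᵀ` yield,
for the new point `x` and any `w` with `D w` finite, `D w + ½‖w - x‖_L² ≤ D x + ½‖w - z‖_L²`
(`dist_step`, `par_step`).

Take `w` to be a maximizer and the previous iterate, and weight the two inequalities by `T` and `T(T
- 1)`, where `T` is the new momentum parameter. Then `t_k² V_k + ½‖x⋆ - (t_k x_k - (t_k - 1)
x_{k-1})‖_L²` does not increase, `V_k` being the dual gap; the rate follows from `t_k ≥ (k + 1)/2`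
(`accelerated_rate`).

The subproblems are solvable because a strongly convex function plus a proper closed convex one is
coercive and lower semicontinuous (`exists_isArgmin`), and the conjugates of the `g_i` are again
proper closed convex. -/

theorem Matrix.IsHermitian.dotProduct_mulVec_comm (hL : L.IsHermitian) (x y : ι → ℝ) :
    x ⬝ᵥ (L *ᵥ y) = y ⬝ᵥ (L *ᵥ x) := by
  have h : Lᵀ = L := by simpa [Matrix.IsHermitian, Matrix.conjTranspose_eq_transpose_of_trivial] using hL
  rw [Matrix.dotProduct_mulVec, ← Matrix.mulVec_transpose, h, dotProduct_comm]

theorem normSq_add (hL : L.IsHermitian) (x y : ι → ℝ) :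
    normSq L (x + y) = normSq L x + 2 * (x ⬝ᵥ (L *ᵥ y)) + normSq L y := by
  simp only [normSq, Matrix.mulVec_add, dotProduct_add, add_dotProduct]
  rw [hL.dotProduct_mulVec_comm y x]
  ring

theorem normSq_sub (hL : L.IsHermitian) (x y : ι → ℝ) :
    normSq L (x - y) = normSq L x - 2 * (x ⬝ᵥ (L *ᵥ y)) + normSq L y := by
  simp only [normSq, Matrix.mulVec_sub, dotProduct_sub, sub_dotProduct]
  rw [hL.dotProduct_mulVec_comm y x]
  ring

theorem normSq_smul (L : Matrix ι ι ℝ) (a : ℝ) (x : ι → ℝ) :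
    normSq L (a • x) = a ^ 2 * normSq L x := by
  simp only [normSq, Matrix.mulVec_smul, dotProduct_smul, smul_dotProduct, smul_eq_mul]
  ring

theorem normSq_zero (L : Matrix ι ι ℝ) : normSq L 0 = 0 := by simp [normSq]

theorem Matrix.PosSemidef.normSq_nonneg (hL : L.PosSemidef) (x : ι → ℝ) : 0 ≤ normSq L x := by
  simpa [normSq] using hL.dotProduct_mulVec_nonneg x

theorem continuous_normSq (L : Matrix ι ι ℝ) : Continuous (normSq L) := by
  unfold normSq
  fun_prop

/-- The form attains a positive minimum on the compact unit sphere; homogeneity does the rest. -/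
theorem Matrix.PosDef.exists_mul_sq_norm_le_normSq (hL : L.PosDef) :
    ∃ c : ℝ, 0 < c ∧ ∀ x : ι → ℝ, c * ‖x‖ ^ 2 ≤ normSq L x := by
  have key : ∃ c : ℝ, 0 < c ∧ ∀ x ∈ Metric.sphere (0 : ι → ℝ) 1, c ≤ normSq L x := by
    -- The sphere is empty when `ι` is empty.
    rcases (Metric.sphere (0 : ι → ℝ) 1).eq_empty_or_nonempty with he | hne
    · exact ⟨1, one_pos, by simp [he]⟩
    · obtain ⟨x, hx, hmin⟩ := (isCompact_sphere (0 : ι → ℝ) 1).exists_isMinOn hne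
        (continuous_normSq L).continuousOn
      refine ⟨normSq L x, ?_, fun y hy => hmin hy⟩
      have hx0 : x ≠ 0 := by
        rintro rfl
        simp at hx
      simpa [normSq] using hL.dotProduct_mulVec_pos hx0
  obtain ⟨c, hc, h⟩ := key
  refine ⟨c, hc, fun x => ?_⟩
  rcases eq_or_ne x 0 with rfl | hx
  · simp [normSq_zero]
  · have hn : 0 < ‖x‖ := norm_pos_iff.2 hx
    have h1 := h (‖x‖⁻¹ • x) (by simp [norm_smul, hn.ne'])
    rw [normSq_smul] at h1
    calc c * ‖x‖ ^ 2 ≤ (‖x‖⁻¹ ^ 2 * normSq L x) * ‖x‖ ^ 2 := by gcongr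
      _ = normSq L x := by field_simp

end NormSq

/-! ### Strong convexity: quadratic growth and existence of minimizers. -/

section StrongConvexity

variable {ι : Type*} [Fintype ι] {H : Matrix ι ι ℝ} {f : (ι → ℝ) → ℝ} {h : (ι → ℝ) → EReal}

/-- Lets the multiplier term of the primal subproblem be absorbed into `f` without changing the
modulus. -/
theorem StronglyConvexWith.add_linear (hf : StronglyConvexWith f H) (w : ι → ℝ) :
    StronglyConvexWith (fun x => f x + x ⬝ᵥ w) H := by
  have hd : ∀ x, HasFDerivAt (fun x : ι → ℝ => x ⬝ᵥ w)
      (LinearMap.toContinuousLinearMap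
        (⟨⟨fun x => x ⬝ᵥ w, fun x y => add_dotProduct x y w⟩,
          fun c x => smul_dotProduct c x w⟩ : (ι → ℝ) →ₗ[ℝ] ℝ)) x := fun x =>
    (LinearMap.toContinuousLinearMap
        (⟨⟨fun x => x ⬝ᵥ w, fun x y => add_dotProduct x y w⟩,
          fun c x => smul_dotProduct c x w⟩ : (ι → ℝ) →ₗ[ℝ] ℝ)).hasFDerivAt
  refine ⟨hf.posDef, fun x => (hf.differentiable x).fun_add (hd x).differentiableAt, fun x y => ?_⟩
  rw [((hf.differentiable y).hasFDerivAt.fun_add (hd y)).fderiv]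
  have h1 := hf.lower_bound x y
  have h2 : (x - y) ⬝ᵥ w = x ⬝ᵥ w - y ⬝ᵥ w := sub_dotProduct _ _ _
  simp only [add_apply, LinearMap.coe_toContinuousLinearMap', LinearMap.coe_mk,
    AddHom.coe_mk] at *
  linarith

/-- Puts the proximal step in the same framework as the primal one: the quadratic plays the role of
`f`, the prox function that of `h`. -/
theorem Matrix.PosDef.stronglyConvexWith_half_normSq (hH : H.PosDef) (a : ι → ℝ) :
    StronglyConvexWith (fun x => 1 / 2 * normSq H (x - a)) H := by
  have hB : ∀ x, HasFDerivAt (fun x : ι → ℝ => 1 / 2 * normSq H (x - a))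
      (LinearMap.toContinuousLinearMap
        (⟨⟨fun u => u ⬝ᵥ (H *ᵥ (x - a)), fun u v => add_dotProduct u v _⟩,
          fun c u => smul_dotProduct c u _⟩ : (ι → ℝ) →ₗ[ℝ] ℝ)) x := by
    intro x
    obtain ⟨C, hC⟩ : ∃ C : ℝ, ∀ u : ι → ℝ, ‖normSq H u‖ ≤ C * ‖u‖ ^ 2 := by
      let T := LinearMap.toContinuousLinearMap H.mulVecLin
      refine ⟨Fintype.card ι * ‖T‖, fun u => ?_⟩
      calc ‖normSq H u‖ ≤ ∑ i, ‖u i * (H *ᵥ u) i‖ := norm_sum_le _ _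
        _ ≤ ∑ _i : ι, ‖u‖ * (‖T‖ * ‖u‖) := by
          refine Finset.sum_le_sum fun i _ => ?_
          rw [norm_mul]
          exact mul_le_mul (norm_le_pi_norm u i)
            ((norm_le_pi_norm (H *ᵥ u) i).trans (T.le_opNorm u)) (norm_nonneg _) (norm_nonneg _)
        _ = _ := by simp; ring
    refine HasFDerivAt.of_isLittleO ?_
    have hO : (fun y : ι → ℝ => normSq H (y - x)) =O[nhds x] fun y => ‖y - x‖ ^ 2 :=
      Asymptotics.IsBigO.of_bound C (Filter.Eventually.of_forall fun y => by
        simpa using hC (y - x))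
    have ho : (fun y : ι → ℝ => ‖y - x‖ ^ 2) =o[nhds x] fun y => y - x :=
      Asymptotics.isLittleO_pow_sub_sub x one_lt_two
    refine ((hO.const_mul_left (1 / 2)).trans_isLittleO ho).congr_left fun y => ?_
    have h1 := normSq_add hH.isHermitian (y - x) (x - a)
    rw [sub_add_sub_cancel] at h1
    simp only [LinearMap.coe_toContinuousLinearMap', LinearMap.coe_mk, AddHom.coe_mk]
    linarith
  refine ⟨hH, fun x => (hB x).differentiableAt, fun x y => ?_⟩
  rw [(hB y).fderiv]
  have h1 := normSq_add hH.isHermitian (x - y) (y - a)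
  rw [sub_add_sub_cancel] at h1
  simp only [LinearMap.coe_toContinuousLinearMap', LinearMap.coe_mk, AddHom.coe_mk]
  linarith

/-- Add the lower bounds based at the intermediate point, weighted by `θ` and `1 - θ`: the
derivative terms cancel. -/
theorem StronglyConvexWith.le_convex_combination (hf : StronglyConvexWith f H) (x y : ι → ℝ)
    {θ : ℝ} (h0 : 0 ≤ θ) (h1 : θ ≤ 1) :
    f (y + θ • (x - y)) ≤
      (1 - θ) * f y + θ * f x - 1 / 2 * (θ * (1 - θ)) * normSq H (x - y) := by
  set w := y + θ • (x - y) with hw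
  have ex : x - w = (1 - θ) • (x - y) := by rw [hw]; module
  have ey : y - w = (-θ) • (x - y) := by rw [hw]; module
  have hx := hf.lower_bound x w
  have hy := hf.lower_bound y w
  rw [ex, normSq_smul, map_smul, smul_eq_mul] at hx
  rw [ey, normSq_smul, map_smul, smul_eq_mul] at hy
  have hx' := mul_le_mul_of_nonneg_left hx.le h0
  have hy' := mul_le_mul_of_nonneg_left hy.le (sub_nonneg.2 h1)
  linear_combination hx' + hy'

theorem le_of_forall_one_sub_mul_le {a b : ℝ} (h : ∀ θ : ℝ, 0 < θ → θ < 1 → (1 - θ) * a ≤ b) :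
    a ≤ b := by
  have ht : Filter.Tendsto (fun θ : ℝ => (1 - θ) * a) (nhdsWithin 0 (Set.Ioi 0)) (nhds a) := by
    have : Continuous fun θ : ℝ => (1 - θ) * a := by fun_prop
    simpa using (this.tendsto 0).mono_left nhdsWithin_le_nhds
  refine le_of_tendsto ht ?_
  filter_upwards [Ioo_mem_nhdsGT (zero_lt_one' ℝ)] with θ hθ using h θ hθ.1 hθ.2

/-- Quadratic growth of `f + h` at a minimizer, when `f` is strongly convex. -/
theorem StronglyConvexWith.quadratic_growth (hf : StronglyConvexWith f H)
    (hh : ProperClosedConvex h) {y : ι → ℝ} (hy : IsArgmin (fun x => (f x : EReal) + h x) y) :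
    ∃ r : ℝ, h y = r ∧ ∀ (x : ι → ℝ) (s : ℝ), h x ≤ s →
      f y + r + 1 / 2 * normSq H (x - y) ≤ f x + s := by
  obtain ⟨x₀, hx₀⟩ := hh.exists_ne_top
  have htop : h y ≠ ⊤ := by
    intro ht
    have := hy x₀
    simp only [ht, EReal.coe_add_top, top_le_iff] at this
    exact EReal.add_ne_top (EReal.coe_ne_top _) hx₀ this
  refine ⟨(h y).toReal, (EReal.coe_toReal htop (hh.ne_bot y)).symm, fun x s hs => ?_⟩
  have hr : h y = ((h y).toReal : EReal) := (EReal.coe_toReal htop (hh.ne_bot y)).symm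
  set r := (h y).toReal
  -- Compare `y` with `y + θ(x - y)`, divide by `θ` and let `θ → 0⁺`.
  have key := le_of_forall_one_sub_mul_le
    (a := 1 / 2 * normSq H (x - y)) (b := f x + s - (f y + r)) fun θ h0 h1 => by
      have hepi := hh.convex (x := (y, r)) (y := (x, s)) hr.le hs (sub_nonneg.2 h1.le) h0.le
        (by ring)
      have e : (1 - θ) • y + θ • x = y + θ • (x - y) := by module
      simp only [Prod.smul_mk, Prod.mk_add_mk, Set.mem_ofPred_eq, e, smul_eq_mul] at hepi
      have h2 : ((f y + r : ℝ) : EReal) ≤ ((f (y + θ • (x - y)) + ((1 - θ) * r + θ * s) : ℝ)) := by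
        calc ((f y + r : ℝ) : EReal) = f y + h y := by rw [hr, EReal.coe_add]
          _ ≤ f (y + θ • (x - y)) + h (y + θ • (x - y)) := hy _
          _ ≤ f (y + θ • (x - y)) + (((1 - θ) * r + θ * s : ℝ) : EReal) :=
            add_le_add_right hepi _
          _ = _ := by rw [EReal.coe_add (f _)]
      rw [EReal.coe_le_coe_iff] at h2
      have h3 := hf.le_convex_combination x y h0.le h1.le
      have h4 : θ * ((1 - θ) * (1 / 2 * normSq H (x - y))) ≤ θ * (f x + s - (f y + r)) := by
        linarith
      exact le_of_mul_le_mul_left h4 h0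
  linarith

/-- Convexity along the segment from `x₀` to `x`, at distance 1 from `x₀`, where `h` is at least its
minimum over the unit ball. -/
theorem ProperClosedConvex.exists_linear_lower_bound (hh : ProperClosedConvex h) :
    ∃ (x₀ : ι → ℝ) (r K : ℝ), h x₀ = r ∧ ∀ (x : ι → ℝ) (s : ℝ), 1 ≤ ‖x - x₀‖ → h x ≤ s →
      r - K * ‖x - x₀‖ ≤ s := by
  obtain ⟨x₀, hx₀⟩ := hh.exists_ne_top
  have hr : h x₀ = ((h x₀).toReal : EReal) := (EReal.coe_toReal hx₀ (hh.ne_bot x₀)).symm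
  set r := (h x₀).toReal
  obtain ⟨u, -, hu⟩ := (hh.closed.lowerSemicontinuousOn (Metric.closedBall x₀ 1)).exists_isMinOn
    ⟨x₀, by simp⟩ (isCompact_closedBall x₀ 1)
  have hutop : h u ≠ ⊤ := fun ht => hx₀ (top_le_iff.1 (ht ▸ hu (by simp : x₀ ∈ _)))
  have hm : h u = ((h u).toReal : EReal) := (EReal.coe_toReal hutop (hh.ne_bot u)).symm
  set m := (h u).toReal
  refine ⟨x₀, r, r - m, hr, fun x s hx hs => ?_⟩
  set ρ := ‖x - x₀‖ with hρ
  have hρ0 : 0 < ρ := by linarith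
  have hθ1 : ρ⁻¹ ≤ 1 := inv_le_one_of_one_le₀ hx
  have hepi := hh.convex (x := (x₀, r)) (y := (x, s)) hr.le hs (sub_nonneg.2 hθ1)
    (inv_pos.2 hρ0).le (by ring)
  have e : (1 - ρ⁻¹) • x₀ + ρ⁻¹ • x = x₀ + ρ⁻¹ • (x - x₀) := by module
  simp only [Prod.smul_mk, Prod.mk_add_mk, Set.mem_ofPred_eq, e, smul_eq_mul] at hepi
  have hball : x₀ + ρ⁻¹ • (x - x₀) ∈ Metric.closedBall x₀ 1 := by
    simp [norm_smul, ← hρ, abs_of_pos hρ0, hρ0.ne']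
  have h1 : (m : EReal) ≤ (((1 - ρ⁻¹) * r + ρ⁻¹ * s : ℝ) : EReal) :=
    hm ▸ (hu hball).trans hepi
  rw [EReal.coe_le_coe_iff] at h1
  have h2 := mul_le_mul_of_nonneg_left h1 hρ0.le
  have h3 : ρ * ((1 - ρ⁻¹) * r + ρ⁻¹ * s) = (ρ - 1) * r + s := by field_simp
  linarith

theorem StronglyConvexWith.exists_isArgmin (hf : StronglyConvexWith f H)
    (hh : ProperClosedConvex h) : ∃ y, IsArgmin (fun x => (f x : EReal) + h x) y := by
  obtain ⟨x₀, r, K, hr, hK⟩ := hh.exists_linear_lower_bound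
  obtain ⟨c, hc, hcoer⟩ := hf.posDef.exists_mul_sq_norm_le_normSq
  -- Beyond this radius `c/2 ‖x - x₀‖²` outweighs the linear losses from the derivative of `f` and
  -- from `h`; the `1` is needed for `hK`.
  set R : ℝ := max 1 (2 * (‖fderiv ℝ f x₀‖ + K) / c) with hR
  have hlsc : LowerSemicontinuous fun x => (f x : EReal) + h x := by
    refine LowerSemicontinuous.add' ?_ hh.closed fun x => EReal.continuousAt_add (by simp) (by simp)
    exact (continuous_coe_real_ereal.comp hf.differentiable.continuous).lowerSemicontinuous
  obtain ⟨y, -, hy⟩ := (hlsc.lowerSemicontinuousOn (Metric.closedBall x₀ R)).exists_isMinOn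
    ⟨x₀, by simp [hR]⟩ (isCompact_closedBall x₀ R)
  refine ⟨y, fun x => ?_⟩
  by_cases hx : x ∈ Metric.closedBall x₀ R
  · exact hy hx
  have h0 : (f y : EReal) + h y ≤ f x₀ + h x₀ := hy (by simp [hR])
  refine h0.trans ?_
  change (f x₀ : EReal) + h x₀ ≤ f x + h x
  by_cases hxt : h x = ⊤
  · simp [hxt]
  have hs : h x = ((h x).toReal : EReal) := (EReal.coe_toReal hxt (hh.ne_bot x)).symm
  set s := (h x).toReal
  rw [Metric.mem_closedBall, dist_eq_norm, not_le, hR, max_lt_iff, div_lt_iff₀ hc] at hx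
  have h1 := hK x s hx.1.le hs.le
  have h2 := hf.lower_bound x x₀
  have h3 := hcoer (x - x₀)
  have h4 : -(‖fderiv ℝ f x₀‖ * ‖x - x₀‖) ≤ fderiv ℝ f x₀ (x - x₀) :=
    (abs_le.1 ((fderiv ℝ f x₀).le_opNorm (x - x₀))).1
  have h5 := mul_le_mul_of_nonneg_right hx.2.le (norm_nonneg (x - x₀))
  rw [hr, hs, ← EReal.coe_add, ← EReal.coe_add, EReal.coe_le_coe_iff]
  nlinarith

end StrongConvexity

/-! ### Conjugate functions. -/

section Conjugate

variable {ι : Type*} [Fintype ι] {g : (ι → ℝ) → EReal}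

theorem conj_le_coe_iff (φ : (ι → ℝ) → EReal) (y : ι → ℝ) (s : EReal) :
    conj φ y ≤ s ↔ ∀ x, ((y ⬝ᵥ x : ℝ) : EReal) - φ x ≤ s := by
  simp [conj, iSup_le_iff]

theorem le_conj (φ : (ι → ℝ) → EReal) (y x : ι → ℝ) :
    ((y ⬝ᵥ x : ℝ) : EReal) - φ x ≤ conj φ y :=
  le_iSup (fun x => ((y ⬝ᵥ x : ℝ) : EReal) - φ x) x

open Classical in
theorem ProperClosedConvex.conj_properClosedConvex (hg : ProperClosedConvex g) :
    ProperClosedConvex (conj g) where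
  ne_bot y := by
    obtain ⟨x, hx⟩ := hg.exists_ne_top
    intro hb
    have := le_conj g y x
    rw [hb, le_bot_iff, ← EReal.coe_toReal hx (hg.ne_bot x), ← EReal.coe_sub] at this
    exact EReal.coe_ne_bot _ this
  exists_ne_top := by
    -- If `y` minimizes `½‖x‖² + g`, quadratic growth there is exactly an affine minorant of `g`
    -- with slope `-y`, so the conjugate is finite at `-y`.
    have hone : (1 : Matrix ι ι ℝ).PosDef := Matrix.PosDef.one
    have hq := hone.stronglyConvexWith_half_normSq 0
    obtain ⟨y, hy⟩ := hq.exists_isArgmin hg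
    obtain ⟨r, hr, hgrow⟩ := hq.quadratic_growth hg hy
    refine ⟨-y, ne_top_of_le_ne_top (EReal.coe_ne_top (-(normSq 1 y + r)))
      ((conj_le_coe_iff _ _ _).2 fun x => ?_)⟩
    by_cases hx : g x = ⊤
    · simp [hx]
    · rw [← EReal.coe_toReal hx (hg.ne_bot x), ← EReal.coe_sub, EReal.coe_le_coe_iff]
      have h1 := hgrow x _ (EReal.coe_toReal hx (hg.ne_bot x)).ge
      rw [normSq_sub hone.isHermitian x y] at h1
      have h2 : x ⬝ᵥ ((1 : Matrix ι ι ℝ) *ᵥ y) = y ⬝ᵥ x := by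
        rw [Matrix.one_mulVec, dotProduct_comm]
      rw [h2] at h1
      simp only [sub_zero] at h1
      rw [neg_dotProduct]
      linarith
  closed := by
    refine lowerSemicontinuous_iSup fun x => Continuous.lowerSemicontinuous ?_
    by_cases hx : g x = ⊤
    · simp only [hx, EReal.sub_top]
      exact continuous_const
    · rw [← EReal.coe_toReal hx (hg.ne_bot x)]
      simp only [← EReal.coe_sub]
      exact continuous_coe_real_ereal.comp (by fun_prop)
  convex := by
    have : {q : (ι → ℝ) × ℝ | conj g q.1 ≤ (q.2 : EReal)} =
        ⋂ x, {q : (ι → ℝ) × ℝ | ((q.1 ⬝ᵥ x : ℝ) : EReal) - g x ≤ q.2} := by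
      ext q
      simp [conj_le_coe_iff]
    rw [this]
    refine convex_iInter fun x => ?_
    by_cases hx : g x = ⊤
    · simp [hx, convex_univ]
    · rw [← EReal.coe_toReal hx (hg.ne_bot x)]
      simp only [← EReal.coe_sub, EReal.coe_le_coe_iff]
      intro p hp q hq a b ha hb hab
      simp only [Set.mem_ofPred_eq, Prod.fst_add, Prod.smul_fst, Prod.snd_add, Prod.smul_snd,
        add_dotProduct, smul_dotProduct, smul_eq_mul] at *
      have := mul_le_mul_of_nonneg_left hp ha
      have := mul_le_mul_of_nonneg_left hq hb
      have e : (g x).toReal = a * (g x).toReal + b * (g x).toReal := by rw [← add_mul, hab, one_mul]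
      linarith

end Conjugate

/-! ### Finite sums of extended reals. -/

section ERealSums

variable {ι : Type*}

theorem EReal.coe_finset_sum (s : Finset ι) (a : ι → ℝ) :
    ((∑ i ∈ s, a i : ℝ) : EReal) = ∑ i ∈ s, (a i : EReal) := by
  classical
  induction s using Finset.induction_on with
  | empty => simp
  | insert i s hi ih => rw [Finset.sum_insert hi, Finset.sum_insert hi, EReal.coe_add, ih]

theorem EReal.finset_sum_ne_bot {s : Finset ι} {a : ι → EReal} (h : ∀ i ∈ s, a i ≠ ⊥) :
    ∑ i ∈ s, a i ≠ ⊥ := by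
  classical
  induction s using Finset.induction_on with
  | empty => simp
  | insert i s hi ih =>
    rw [Finset.sum_insert hi]
    exact EReal.add_ne_bot_iff.2 ⟨h i (Finset.mem_insert_self i s),
      ih fun j hj => h j (Finset.mem_insert_of_mem hj)⟩

/-- Since `⊤ + ⊥ = ⊥`, the other summands must avoid `⊥`. -/
theorem EReal.finset_sum_eq_top {s : Finset ι} {a : ι → EReal} (h : ∀ i ∈ s, a i ≠ ⊥) {i : ι}
    (hi : i ∈ s) (ha : a i = ⊤) : ∑ j ∈ s, a j = ⊤ := by
  classical
  rw [← Finset.add_sum_erase s a hi, ha]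
  exact EReal.top_add_of_ne_bot
    (EReal.finset_sum_ne_bot fun j hj => h j (Finset.mem_of_mem_erase hj))

/-- Allows a sum of suprema to be approached by choosing a near-optimal point in each block
separately. -/
theorem EReal.exists_lt_of_lt_finset_sum (s : Finset ι) (c : ι → EReal) {T : EReal}
    (hT : T < ∑ i ∈ s, c i) : ∃ r : ι → EReal, (∀ i ∈ s, r i < c i) ∧ T < ∑ i ∈ s, r i := by
  classical
  induction s using Finset.induction_on generalizing T with
  | empty => exact ⟨0, by simp, by simpa using hT⟩
  | insert i s hi ih =>
    rw [Finset.sum_insert hi] at hT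
    obtain ⟨a, ha, b, hb, hab⟩ : ∃ a < c i, ∃ b < ∑ j ∈ s, c j, T < a + b := by
      by_contra! hcon
      exact hT.not_ge (EReal.add_le_of_forall_lt hcon)
    obtain ⟨r, hr, hbr⟩ := ih hb
    refine ⟨Function.update r i a, fun j hj => ?_, ?_⟩
    · rcases eq_or_ne j i with rfl | hji
      · simpa using ha
      · simpa [hji] using hr j (Finset.mem_of_mem_insert_of_ne hj hji)
    · rw [Finset.sum_insert hi, Function.update_self, Finset.sum_update_of_notMem hi]
      exact hab.trans_le (add_le_add_right hbr.le a)

theorem exists_coe_of_ne {a : EReal} (hb : a ≠ ⊥) (ht : a ≠ ⊤) : ∃ r : ℝ, a = r :=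
  ⟨a.toReal, (EReal.coe_toReal ht hb).symm⟩

end ERealSums

/-! ### Stacked vectors and block diagonal matrices. -/

section Blocks

variable {M : ℕ} {s : Fin M → ℕ}

theorem dotProduct_eq_sum_block (x y : BlockIdx s → ℝ) :
    x ⬝ᵥ y = ∑ i, block x i ⬝ᵥ block y i :=
  Fintype.sum_sigma _

theorem block_blockDiagonal'_mulVec (L : ∀ i, Matrix (Fin (s i)) (Fin (s i)) ℝ)
    (x : BlockIdx s → ℝ) (i : Fin M) :
    block (Matrix.blockDiagonal' L *ᵥ x) i = L i *ᵥ block x i := by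
  funext a
  simp only [block, Matrix.mulVec, dotProduct]
  rw [Fintype.sum_sigma, Finset.sum_eq_single i]
  · simp [Matrix.blockDiagonal'_apply]
  · intro j _ hj
    refine Finset.sum_eq_zero fun b _ => ?_
    rw [Matrix.blockDiagonal'_apply_ne _ _ _ hj.symm, zero_mul]
  · simp

theorem normSq_blockDiagonal' (L : ∀ i, Matrix (Fin (s i)) (Fin (s i)) ℝ) (x : BlockIdx s → ℝ) :
    normSq (Matrix.blockDiagonal' L) x = ∑ i, normSq (L i) (block x i) := by
  simp only [normSq, dotProduct_eq_sum_block, block_blockDiagonal'_mulVec]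

theorem Matrix.PosDef.blockDiagonal'_fin {L : ∀ i, Matrix (Fin (s i)) (Fin (s i)) ℝ}
    (hL : ∀ i, (L i).PosDef) : (Matrix.blockDiagonal' L).PosDef := by
  refine Matrix.PosDef.of_dotProduct_mulVec_pos ?_ fun x hx => ?_
  · rw [Matrix.IsHermitian, Matrix.blockDiagonal'_conjTranspose]
    congr 1
    funext i
    exact (hL i).isHermitian
  · rw [star_trivial]
    change 0 < normSq _ x
    rw [normSq_blockDiagonal']
    obtain ⟨⟨i, a⟩, ha⟩ := Function.ne_iff.1 hx
    refine Finset.sum_pos' (fun i _ => (hL i).posSemidef.normSq_nonneg _) ⟨i, Finset.mem_univ i, ?_⟩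
    have : block x i ≠ 0 := fun h => ha (congrFun h a)
    simpa [normSq] using (hL i).dotProduct_mulVec_pos this

theorem normSq_distL {m p : Fin M → ℕ} (Llam : ∀ i, Matrix (Fin (m i)) (Fin (m i)) ℝ)
    (Lmu : ∀ i, Matrix (Fin (p i)) (Fin (p i)) ℝ) (x : BlockIdx m ⊕ BlockIdx p → ℝ) :
    normSq (distL Llam Lmu) x = ∑ i, normSq (Llam i) (block (fun a => x (Sum.inl a)) i) +
      ∑ i, normSq (Lmu i) (block (fun a => x (Sum.inr a)) i) := by
  rw [← normSq_blockDiagonal', ← normSq_blockDiagonal']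
  simp only [normSq, distL, Matrix.fromBlocks_mulVec, dotProduct, Fintype.sum_sum_type,
    Sum.elim_inl, Sum.elim_inr, Matrix.zero_mulVec, add_zero, zero_add, Function.comp_def]

theorem isHermitian_distL {m p : Fin M → ℕ} {Llam : ∀ i, Matrix (Fin (m i)) (Fin (m i)) ℝ}
    {Lmu : ∀ i, Matrix (Fin (p i)) (Fin (p i)) ℝ} (hl : ∀ i, (Llam i).PosDef)
    (hm : ∀ i, (Lmu i).PosDef) : (distL Llam Lmu).IsHermitian :=
  Matrix.IsHermitian.fromBlocks (Matrix.PosDef.blockDiagonal'_fin hl).isHermitian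
    (by simp) (Matrix.PosDef.blockDiagonal'_fin hm).isHermitian

/-- The conjugate of a separable function is the sum of the conjugates. -/
theorem conj_separable {g : ∀ i, (Fin (s i) → ℝ) → EReal} (hg : ∀ i x, g i x ≠ ⊥)
    (w : BlockIdx s → ℝ) :
    conj (fun x : BlockIdx s → ℝ => ∑ i, g i (block x i)) w = ∑ i, conj (g i) (block w i) := by
  have split : ∀ (x : BlockIdx s → ℝ) (q : Fin M → ℝ), (∀ i, g i (block x i) = q i) →
      ((w ⬝ᵥ x : ℝ) : EReal) - ∑ i, g i (block x i) =
        ∑ i, (((block w i ⬝ᵥ block x i : ℝ) : EReal) - g i (block x i)) := by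
    intro x q hq
    simp only [hq, ← EReal.coe_sub, ← EReal.coe_finset_sum]
    rw [Finset.sum_sub_distrib, dotProduct_eq_sum_block]
  apply le_antisymm
  · refine (conj_le_coe_iff _ _ _).2 fun x => ?_
    by_cases hx : ∃ i, g i (block x i) = ⊤
    · obtain ⟨i, hi⟩ := hx
      rw [EReal.finset_sum_eq_top (fun j _ => hg j _) (Finset.mem_univ i) hi]
      simp
    · push Not at hx
      choose q hq using fun i => exists_coe_of_ne (hg i (block x i)) (hx i)
      rw [split x q hq]
      exact Finset.sum_le_sum fun i _ => le_conj (g i) (block w i) (block x i)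
  · refine le_of_forall_lt fun T hT => ?_
    obtain ⟨r, hr, hTr⟩ := EReal.exists_lt_of_lt_finset_sum _ _ hT
    have hx : ∀ i, ∃ x, r i < ((block w i ⬝ᵥ x : ℝ) : EReal) - g i x := fun i =>
      lt_iSup_iff.1 (hr i (Finset.mem_univ i))
    choose x hx using hx
    have hne : ∀ i, g i (x i) ≠ ⊤ := fun i hi => by
      have := hx i
      rw [hi, EReal.sub_top] at this
      exact not_lt_bot this
    choose q hq using fun i => exists_coe_of_ne (hg i (x i)) (hne i)
    calc T < ∑ i, r i := hTr
      _ ≤ ∑ i, (((block w i ⬝ᵥ x i : ℝ) : EReal) - g i (x i)) :=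
        Finset.sum_le_sum fun i _ => (hx i).le
      _ = ((w ⬝ᵥ stack x : ℝ) : EReal) - ∑ i, g i (block (stack x) i) := (split (stack x) q hq).symm
      _ ≤ _ := le_conj (fun x : BlockIdx s → ℝ => ∑ i, g i (block x i)) w (stack x)

end Blocks

/-! ### Neighbour sums as products with the full matrices. -/

namespace Problem

variable {M : ℕ} {n m p : Fin M → ℕ} (P : Problem M n m p)

/-- The blocks left out of the neighbour sum are zero; likewise in the next three lemmas. -/
theorem sum_rowNbrs_A (y : ∀ i, Fin (n i) → ℝ) (i : Fin M) :
    ∑ j ∈ P.rowNbrs i, P.A i j *ᵥ y j = block (P.fullA *ᵥ stack y) i := by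
  classical
  have : ∑ j ∈ P.rowNbrs i, P.A i j *ᵥ y j = ∑ j, P.A i j *ᵥ y j := by
    refine Finset.sum_subset (Finset.subset_univ _) fun j _ hj => ?_
    simp only [rowNbrs, Finset.mem_filter, Finset.mem_univ, true_and, not_or, not_not] at hj
    rw [hj.1, Matrix.zero_mulVec]
  rw [this]
  funext a
  simp only [block, Matrix.mulVec, dotProduct, Fintype.sum_sigma, Finset.sum_apply]
  rfl

theorem sum_rowNbrs_B (y : ∀ i, Fin (n i) → ℝ) (i : Fin M) :
    ∑ j ∈ P.rowNbrs i, P.B i j *ᵥ y j = block (P.fullB *ᵥ stack y) i := by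
  classical
  have : ∑ j ∈ P.rowNbrs i, P.B i j *ᵥ y j = ∑ j, P.B i j *ᵥ y j := by
    refine Finset.sum_subset (Finset.subset_univ _) fun j _ hj => ?_
    simp only [rowNbrs, Finset.mem_filter, Finset.mem_univ, true_and, not_or, not_not] at hj
    rw [hj.2, Matrix.zero_mulVec]
  rw [this]
  funext a
  simp only [block, Matrix.mulVec, dotProduct, Fintype.sum_sigma, Finset.sum_apply]
  rfl

theorem sum_colNbrs_A (z : ∀ i, Fin (m i) → ℝ) (i : Fin M) :
    ∑ j ∈ P.colNbrs i, (P.A j i)ᵀ *ᵥ z j = block (P.fullAᵀ *ᵥ stack z) i := by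
  classical
  have : ∑ j ∈ P.colNbrs i, (P.A j i)ᵀ *ᵥ z j = ∑ j, (P.A j i)ᵀ *ᵥ z j := by
    refine Finset.sum_subset (Finset.subset_univ _) fun j _ hj => ?_
    simp only [colNbrs, Finset.mem_filter, Finset.mem_univ, true_and, not_or, not_not] at hj
    rw [hj.1, Matrix.transpose_zero, Matrix.zero_mulVec]
  rw [this]
  funext a
  simp only [block, Matrix.mulVec, dotProduct, Fintype.sum_sigma, Finset.sum_apply]
  rfl

theorem sum_colNbrs_B (v : ∀ i, Fin (p i) → ℝ) (i : Fin M) :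
    ∑ j ∈ P.colNbrs i, (P.B j i)ᵀ *ᵥ v j = block (P.fullBᵀ *ᵥ stack v) i := by
  classical
  have : ∑ j ∈ P.colNbrs i, (P.B j i)ᵀ *ᵥ v j = ∑ j, (P.B j i)ᵀ *ᵥ v j := by
    refine Finset.sum_subset (Finset.subset_univ _) fun j _ hj => ?_
    simp only [colNbrs, Finset.mem_filter, Finset.mem_univ, true_and, not_or, not_not] at hj
    rw [hj.2, Matrix.transpose_zero, Matrix.zero_mulVec]
  rw [this]
  funext a
  simp only [block, Matrix.mulVec, dotProduct, Fintype.sum_sigma, Finset.sum_apply]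
  rfl

theorem fullC_transpose_mulVec (l : BlockIdx m → ℝ) (u : BlockIdx p → ℝ) :
    P.fullCᵀ *ᵥ Sum.elim l u = P.fullAᵀ *ᵥ l + P.fullBᵀ *ᵥ u := by
  rw [fullC, Matrix.transpose_fromRows, Matrix.fromCols_mulVec_sumElim]

theorem fullC_mulVec_sub_fullc (y : BlockIdx n → ℝ) :
    P.fullC *ᵥ y - P.fullc = Sum.elim (P.fullA *ᵥ y - stack P.b) (P.fullB *ᵥ y) := by
  funext a
  cases a <;> simp [fullC, fullc, Matrix.fromRows_mulVec]

end Problem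

theorem normSq_mul_mul_transpose {ι κ : Type*} [Fintype ι] [Fintype κ] (C : Matrix ι κ ℝ)
    (K : Matrix κ κ ℝ) (x : ι → ℝ) : normSq (C * K * Cᵀ) x = normSq K (Cᵀ *ᵥ x) := by
  simp only [normSq]
  rw [← Matrix.mulVec_mulVec, ← Matrix.mulVec_mulVec, Matrix.dotProduct_mulVec,
    ← Matrix.mulVec_transpose]

/-- Expand `0 ≤ ‖a + L⁻¹ b‖_L²`. -/
theorem Matrix.PosDef.young {ι : Type*} [Fintype ι] [DecidableEq ι] {L : Matrix ι ι ℝ}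
    (hL : L.PosDef) (a b : ι → ℝ) : 0 ≤ normSq L a + 2 * (a ⬝ᵥ b) + normSq L⁻¹ b := by
  have h := hL.posSemidef.normSq_nonneg (a + L⁻¹ *ᵥ b)
  have hdet : IsUnit L.det := (Matrix.isUnit_iff_isUnit_det L).1 hL.isUnit
  rw [normSq_add hL.isHermitian, Matrix.mulVec_mulVec, Matrix.mul_nonsing_inv _ hdet,
    Matrix.one_mulVec] at h
  have e : normSq L (L⁻¹ *ᵥ b) = normSq L⁻¹ b := by
    rw [normSq, Matrix.mulVec_mulVec, Matrix.mul_nonsing_inv _ hdet, Matrix.one_mulVec,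
      dotProduct_comm, normSq]
  rwa [e] at h

/-- Turns the distance to a gradient step into a linear model plus a proximal term; the last summand
does not involve `w` and drops out of comparisons. -/
theorem normSq_sub_add_inv_mulVec {ι : Type*} [Fintype ι] [DecidableEq ι] {L : Matrix ι ι ℝ}
    (hL : L.PosDef) (w z u : ι → ℝ) :
    normSq L (w - (z + L⁻¹ *ᵥ u)) =
      normSq L (w - z) - 2 * ((w - z) ⬝ᵥ u) + normSq L (L⁻¹ *ᵥ u) := by
  have hdet : IsUnit L.det := (Matrix.isUnit_iff_isUnit_det L).1 hL.isUnit
  rw [← sub_sub, normSq_sub hL.isHermitian, Matrix.mulVec_mulVec, Matrix.mul_nonsing_inv _ hdet,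
    Matrix.one_mulVec]

/-! ### Momentum parameters and the accelerated rate. -/

theorem div_two_le_of_momentum {t : ℕ → ℝ} (h1 : t 1 = 1)
    (ht : ∀ k, 1 ≤ k → t (k + 1) = (1 + √(1 + 4 * t k ^ 2)) / 2) {k : ℕ} (hk : 1 ≤ k) :
    ((k : ℝ) + 1) / 2 ≤ t k := by
  induction k, hk using Nat.le_induction with
  | base => rw [h1]; norm_num
  | succ k hk ih =>
    rw [ht k hk]
    have h0 : 0 ≤ 2 * t k := by
      have : (0 : ℝ) ≤ k := k.cast_nonneg
      linarith
    have : 2 * t k ≤ √(1 + 4 * t k ^ 2) := Real.le_sqrt_of_sq_le (by nlinarith)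
    push_cast
    linarith

/-- The recursion picks a root of `T² - T = t_k²`. -/
theorem momentum_sq_sub {t : ℕ → ℝ} (ht : ∀ k, 1 ≤ k → t (k + 1) = (1 + √(1 + 4 * t k ^ 2)) / 2)
    {k : ℕ} (hk : 1 ≤ k) : t (k + 1) ^ 2 - t (k + 1) = t k ^ 2 := by
  rw [ht k hk]
  have := Real.sq_sqrt (show 0 ≤ 1 + 4 * t k ^ 2 by positivity)
  linarith

/-- On the right, `z` enters only through the first square. Subtracting two instances with different
`z` therefore leaves a difference of two potential terms. -/
theorem normSq_combination {ι : Type*} [Fintype ι] {L : Matrix ι ι ℝ} (hL : L.IsHermitian)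
    (t : ℝ) (a b z : ι → ℝ) :
    t * ((t - 1) * normSq L (a - z) + normSq L (b - z)) =
      normSq L (b - (t • z - (t - 1) • a)) + t * (t - 1) * normSq L a + t * normSq L b
        - normSq L (b + (t - 1) • a) := by
  rw [normSq_sub hL a z, normSq_sub hL b z, normSq_sub hL b, normSq_sub hL (t • z),
    normSq_add hL b]
  simp only [normSq_smul, Matrix.mulVec_sub, Matrix.mulVec_smul, dotProduct_sub, dotProduct_smul,
    smul_dotProduct, smul_eq_mul]
  rw [hL.dotProduct_mulVec_comm z a]
  ring

/-- The `O(1/k²)` rate of an accelerated scheme, from its two one-step inequalities. -/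
theorem accelerated_rate {ι : Type*} [Fintype ι] {L : Matrix ι ι ℝ} (hL : L.IsHermitian)
    (hnn : ∀ x, 0 ≤ normSq L x) {x z : ℕ → ι → ℝ} {xs : ι → ℝ} {t V : ℕ → ℝ}
    (hz1 : z 1 = x 0) (ht1 : t 1 = 1)
    (ht : ∀ k, 1 ≤ k → t (k + 1) = (1 + √(1 + 4 * t k ^ 2)) / 2)
    (hz : ∀ k, 1 ≤ k → z (k + 1) = x k + ((t k - 1) / t (k + 1)) • (x k - x (k - 1)))
    (hstar : ∀ k, 1 ≤ k →
      V k + 1 / 2 * normSq L (xs - x k) ≤ 1 / 2 * normSq L (xs - z k))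
    (hprev : ∀ k, 1 ≤ k →
      V (k + 1) + 1 / 2 * normSq L (x k - x (k + 1)) ≤ V k + 1 / 2 * normSq L (x k - z (k + 1)))
    {k : ℕ} (hk : 1 ≤ k) :
    V k ≤ 2 * normSq L (xs - x 0) / ((k : ℝ) + 1) ^ 2 := by
  have key : t k ^ 2 * V k + 1 / 2 * normSq L (xs - (t k • x k - (t k - 1) • x (k - 1))) ≤
      1 / 2 * normSq L (xs - x 0) := by
    induction k, hk using Nat.le_induction with
    -- As `t 1 = 1`, this is `hstar` alone. `V 0` never occurs, so the starting point may have
    -- infinite gap.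
    | base =>
      have := hstar 1 le_rfl
      rw [hz1] at this
      simpa [ht1] using this
    | succ k hk ih =>
      refine le_trans ?_ ih
      have htpos : (1 : ℝ) ≤ t (k + 1) := by
        have h := div_two_le_of_momentum ht1 ht (k := k + 1) (by omega)
        have h' : (1 : ℝ) ≤ k := by exact_mod_cast hk
        push_cast at h
        linarith
      have hne : t (k + 1) ≠ 0 := by positivity
      -- The extrapolation coefficient is the one that makes this hold.
      have hzu : t (k + 1) • z (k + 1) - (t (k + 1) - 1) • x k =
          t k • x k - (t k - 1) • x (k - 1) := by
        rw [hz k hk, smul_add, smul_smul, mul_div_cancel₀ _ hne]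
        module
      have e1 := normSq_combination hL (t (k + 1)) (x k) xs (z (k + 1))
      have e2 := normSq_combination hL (t (k + 1)) (x k) xs (x (k + 1))
      rw [hzu] at e1
      rw [Nat.add_sub_cancel]
      have hsq := momentum_sq_sub ht hk
      set T := t (k + 1)
      have s1 := mul_le_mul_of_nonneg_left (hprev k hk)
        (mul_nonneg (zero_le_one.trans htpos) (sub_nonneg.2 htpos))
      have s2 := mul_le_mul_of_nonneg_left (hstar (k + 1) (by omega)) (zero_le_one.trans htpos)
      have e3 : T * (T - 1) = t k ^ 2 := by rw [← hsq]; ring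
      rw [← e3]
      linarith
  have hT := div_two_le_of_momentum ht1 ht hk
  have hk0 : (0 : ℝ) < (k : ℝ) + 1 := by positivity
  rw [le_div_iff₀ (by positivity)]
  have h1 : t k ^ 2 * V k ≤ 1 / 2 * normSq L (xs - x 0) := by
    linarith [hnn (xs - (t k • x k - (t k - 1) • x (k - 1)))]
  -- The sign of `V k` is not among the hypotheses, so the lower bound on `t k` is usable only in
  -- the second case.
  rcases le_total (V k) 0 with hV | hV
  · have := mul_nonneg (neg_nonneg.2 hV) (sq_nonneg ((k : ℝ) + 1))
    linarith [hnn (xs - x 0)]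
  · have h2 : (((k : ℝ) + 1) / 2) ^ 2 ≤ t k ^ 2 := by gcongr
    have h3 := mul_le_mul_of_nonneg_right h2 hV
    linarith

/-- The rate in terms of an extended-valued objective that is maximized. -/
theorem accelerated_rate_ereal {ι : Type*} [Fintype ι] {L : Matrix ι ι ℝ} (hL : L.IsHermitian)
    (hnn : ∀ x, 0 ≤ normSq L x) {Φ : (ι → ℝ) → EReal} (hΦ : ∀ w, Φ w ≠ ⊤)
    {x z : ℕ → ι → ℝ} {xs : ι → ℝ} {t : ℕ → ℝ} (hmax : IsArgmax Φ xs)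
    (hz1 : z 1 = x 0) (ht1 : t 1 = 1)
    (ht : ∀ k, 1 ≤ k → t (k + 1) = (1 + √(1 + 4 * t k ^ 2)) / 2)
    (hz : ∀ k, 1 ≤ k → z (k + 1) = x k + ((t k - 1) / t (k + 1)) • (x k - x (k - 1)))
    (hstep : ∀ k, 1 ≤ k → ∃ ρ : ℝ, Φ (x k) = ρ ∧ ∀ (w : ι → ℝ) (s : ℝ), Φ w = s →
      s + 1 / 2 * normSq L (w - x k) ≤ ρ + 1 / 2 * normSq L (w - z k))
    {k : ℕ} (hk : 1 ≤ k) :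
    Φ xs - Φ (x k) ≤ ((2 * normSq L (xs - x 0) / ((k : ℝ) + 1) ^ 2 : ℝ) : EReal) := by
  have hval : ∀ k, 1 ≤ k → Φ (x k) = ((Φ (x k)).toReal : EReal) := fun k hk => by
    obtain ⟨ρ, hρ, -⟩ := hstep k hk
    rw [hρ, EReal.toReal_coe]
  have hxs : Φ xs = ((Φ xs).toReal : EReal) := by
    refine (EReal.coe_toReal (hΦ xs) fun hb => ?_).symm
    have := hmax (x 1)
    rw [hb, hval 1 le_rfl, le_bot_iff] at this
    exact EReal.coe_ne_bot _ this
  have hineq : ∀ k, 1 ≤ k → ∀ w : ι → ℝ, Φ w = ((Φ w).toReal : EReal) →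
      (Φ w).toReal + 1 / 2 * normSq L (w - x k) ≤
        (Φ (x k)).toReal + 1 / 2 * normSq L (w - z k) := fun k hk w hw => by
    obtain ⟨ρ, hρ, h⟩ := hstep k hk
    rw [hρ, EReal.toReal_coe]
    exact h w _ hw
  rw [hxs, hval k hk, ← EReal.coe_sub, EReal.coe_le_coe_iff]
  refine accelerated_rate hL hnn (V := fun k => (Φ xs).toReal - (Φ (x k)).toReal) hz1 ht1 ht hz
    (fun k hk => ?_) (fun k hk => ?_) hk
  · linarith [hineq k hk xs hxs]
  · linarith [hineq (k + 1) (by omega) (x k) (hval k hk)]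

/-! ### Primal and proximal subproblems. -/

section Subproblems

variable {ι : Type*} [Fintype ι]

theorem primal_objective_eq (f : (ι → ℝ) → ℝ) (h : (ι → ℝ) → EReal) (w : ι → ℝ) :
    (fun x => (f x : EReal) + h x + ((x ⬝ᵥ w : ℝ) : EReal)) =
      fun x => ((f x + x ⬝ᵥ w : ℝ) : EReal) + h x := by
  funext x
  rw [EReal.coe_add, add_right_comm]

theorem isProx_iff (ψ : (ι → ℝ) → EReal) (L : Matrix ι ι ℝ) (a y : ι → ℝ) :
    IsProx ψ L a y ↔ IsArgmin (fun w => ((1 / 2 * normSq L (w - a) : ℝ) : EReal) + ψ w) y := by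
  simp only [IsProx, add_comm (ψ _)]

theorem exists_isProx {ψ : (ι → ℝ) → EReal} (hψ : ProperClosedConvex ψ) {L : Matrix ι ι ℝ}
    (hL : L.PosDef) (a : ι → ℝ) : ∃ y, IsProx ψ L a y := by
  simp only [isProx_iff]
  exact (hL.stronglyConvexWith_half_normSq a).exists_isArgmin hψ

/-- The three-point inequality of a generalized proximal gradient step. -/
theorem IsProx.three_point [DecidableEq ι] {ψ : (ι → ℝ) → EReal} (hψ : ProperClosedConvex ψ)
    {L : Matrix ι ι ℝ} (hL : L.PosDef) {v u y : ι → ℝ} (hy : IsProx ψ L (v + L⁻¹ *ᵥ u) y) :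
    ∃ r : ℝ, ψ y = r ∧ ∀ (w : ι → ℝ) (s : ℝ), ψ w ≤ s →
      r - y ⬝ᵥ u + 1 / 2 * normSq L (y - v) + 1 / 2 * normSq L (w - y) ≤
        s - w ⬝ᵥ u + 1 / 2 * normSq L (w - v) := by
  obtain ⟨r, hr, h⟩ := (hL.stronglyConvexWith_half_normSq _).quadratic_growth hψ
    ((isProx_iff _ _ _ _).1 hy)
  refine ⟨r, hr, fun w s hs => ?_⟩
  have := h w s hs
  rw [normSq_sub_add_inv_mulVec hL, normSq_sub_add_inv_mulVec hL, sub_dotProduct,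
    sub_dotProduct] at this
  linarith

/-- With no nonsmooth term the model is an exact quadratic, so equality holds. -/
theorem three_point_of_eq [DecidableEq ι] {L : Matrix ι ι ℝ} (hL : L.PosDef) {z u y : ι → ℝ}
    (hy : y = z + L⁻¹ *ᵥ u) (w : ι → ℝ) :
    - (y ⬝ᵥ u) + 1 / 2 * normSq L (y - z) + 1 / 2 * normSq L (w - y) =
      - (w ⬝ᵥ u) + 1 / 2 * normSq L (w - z) := by
  have h1 := normSq_sub_add_inv_mulVec hL w z u
  have h2 := normSq_sub_add_inv_mulVec hL y z u
  rw [← hy, sub_dotProduct] at h1 h2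
  rw [sub_self, normSq_zero] at h2
  linarith

end Subproblems

/-! ### The dual function, one iteration, well-definedness and rates. -/

namespace Problem

variable {M : ℕ} {n m p : Fin M → ℕ} (P : Problem M n m p)
  {H : ∀ i, Matrix (Fin (n i)) (Fin (n i)) ℝ}

theorem F_eq_coe {x : BlockIdx n → ℝ} {s : Fin M → ℝ} (hs : ∀ i, P.h i (block x i) = s i) :
    P.F x = ((∑ i, P.f i (block x i) + ∑ i, s i : ℝ) : EReal) := by
  simp only [F, hs, ← EReal.coe_finset_sum, ← EReal.coe_add]

variable {P}

/-- Linear upper and quadratic lower bound of the dual function `d`, from a primal minimizer. -/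
theorem Assumptions.dual_bounds (hP : P.Assumptions H) {z : BlockIdx m ⊕ BlockIdx p → ℝ}
    {y : ∀ i, Fin (n i) → ℝ}
    (hy : ∀ i, IsArgmin (fun x : Fin (n i) → ℝ => (P.f i x : EReal) + P.h i x +
      ((x ⬝ᵥ block (P.fullCᵀ *ᵥ z) i : ℝ) : EReal)) (y i)) :
    ∃ r : ℝ, ∀ w : BlockIdx m ⊕ BlockIdx p → ℝ, ∃ dw : ℝ, P.d w = dw ∧
      dw ≤ r + w ⬝ᵥ (P.fullC *ᵥ stack y - P.fullc) ∧
      r + w ⬝ᵥ (P.fullC *ᵥ stack y - P.fullc) - 1 / 2 *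
        normSq (P.fullC * (Matrix.blockDiagonal' H)⁻¹ * P.fullCᵀ) (w - z) ≤ dw := by
  have hgrow := fun i => ((hP.f_strong i).add_linear (block (P.fullCᵀ *ᵥ z) i)).quadratic_growth
    (hP.h_pcc i) (primal_objective_eq (P.f i) (P.h i) _ ▸ hy i)
  choose ρ hρ hgrow using hgrow
  have hHb : (Matrix.blockDiagonal' H).PosDef :=
    Matrix.PosDef.blockDiagonal'_fin fun i => (hP.f_strong i).posDef
  have hFy := P.F_eq_coe (x := stack y) (s := ρ) hρ
  set r := ∑ i, P.f i (block (stack y) i) + ∑ i, ρ i with hr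
  refine ⟨r, fun w => ?_⟩
  have hdot : w ⬝ᵥ (P.fullC *ᵥ stack y) = (P.fullCᵀ *ᵥ w) ⬝ᵥ stack y := by
    rw [Matrix.mulVec_transpose, Matrix.dotProduct_mulVec]
  set Q := normSq (P.fullC * (Matrix.blockDiagonal' H)⁻¹ * P.fullCᵀ) (w - z) with hQ
  have hlow : ((-(P.fullCᵀ *ᵥ w) ⬝ᵥ stack y - r : ℝ) : EReal) ≤
      conj P.F (-(P.fullCᵀ *ᵥ w)) := by
    have := le_conj P.F (-(P.fullCᵀ *ᵥ w)) (stack y)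
    rwa [hFy, ← EReal.coe_sub] at this
  have hup : conj P.F (-(P.fullCᵀ *ᵥ w)) ≤
      ((-(P.fullCᵀ *ᵥ w) ⬝ᵥ stack y - r + 1 / 2 * Q : ℝ) : EReal) := by
    refine (conj_le_coe_iff _ _ _).2 fun x => ?_
    by_cases hx : ∃ i, P.h i (block x i) = ⊤
    · obtain ⟨i, hi⟩ := hx
      have : P.F x = ⊤ := by
        rw [F, EReal.finset_sum_eq_top (fun j _ => (hP.h_pcc j).ne_bot _) (Finset.mem_univ i) hi]
        exact EReal.coe_add_top _
      simp [this]
    push Not at hx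
    choose s hs using fun i => exists_coe_of_ne ((hP.h_pcc i).ne_bot (block x i)) (hx i)
    rw [P.F_eq_coe hs, ← EReal.coe_sub, EReal.coe_le_coe_iff]
    have h1 := Finset.sum_le_sum fun i (_ : i ∈ Finset.univ) =>
      hgrow i (block x i) (s i) (hs i).le
    simp only [Finset.sum_add_distrib, ← Finset.mul_sum] at h1
    have e1 : ∑ i, normSq (H i) (block x i - y i) =
        normSq (Matrix.blockDiagonal' H) (x - stack y) :=
      (normSq_blockDiagonal' H (x - stack y)).symm
    have e2 : ∑ i, y i ⬝ᵥ block (P.fullCᵀ *ᵥ z) i = stack y ⬝ᵥ (P.fullCᵀ *ᵥ z) :=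
      (dotProduct_eq_sum_block (stack y) _).symm
    have e3 : ∑ i, P.f i (y i) = ∑ i, P.f i (block (stack y) i) := rfl
    rw [e1, e2, e3, ← dotProduct_eq_sum_block x] at h1
    -- Young's inequality trades the cross term between `x - y` and the multiplier change for the
    -- growth term in `H`, leaving `½ Q`.
    have h2 := hHb.young (x - stack y) (P.fullCᵀ *ᵥ (w - z))
    rw [← normSq_mul_mul_transpose, ← hQ, Matrix.mulVec_sub, sub_dotProduct, dotProduct_sub,
      dotProduct_sub] at h2
    rw [neg_dotProduct, neg_dotProduct, dotProduct_comm _ x, dotProduct_comm _ (stack y), hr]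
    linarith
  obtain ⟨φ, hφ⟩ := exists_coe_of_ne (ne_bot_of_le_ne_bot (EReal.coe_ne_bot _) hlow)
    (ne_top_of_le_ne_top (EReal.coe_ne_top _) hup)
  rw [hφ, EReal.coe_le_coe_iff, neg_dotProduct] at hlow hup
  refine ⟨-φ - P.fullc ⬝ᵥ w, ?_, ?_, ?_⟩
  · rw [d, hφ, EReal.coe_sub, EReal.coe_neg]
  · rw [dotProduct_sub, hdot, dotProduct_comm w]
    linarith
  · rw [dotProduct_sub, hdot, dotProduct_comm w]
    linarith

theorem Assumptions.gTilde_eq (hP : P.Assumptions H) (ν : BlockIdx m ⊕ BlockIdx p → ℝ) :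
    P.gTilde ν = ∑ i, conj (P.g i) (block (fun a => ν (Sum.inr a)) i) :=
  conj_separable (fun i x => (hP.g_pcc i).ne_bot x) _

theorem Assumptions.gTilde_ne_bot (hP : P.Assumptions H) (ν : BlockIdx m ⊕ BlockIdx p → ℝ) :
    P.gTilde ν ≠ ⊥ := by
  rw [hP.gTilde_eq]
  exact EReal.finset_sum_ne_bot fun i _ => (hP.g_pcc i).conj_properClosedConvex.ne_bot _

theorem Assumptions.exists_primal_argmin (hP : P.Assumptions H) (w : BlockIdx n → ℝ) (i : Fin M) :
    ∃ y, IsArgmin (fun x : Fin (n i) → ℝ => (P.f i x : EReal) + P.h i x +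
      ((x ⬝ᵥ block w i : ℝ) : EReal)) y := by
  rw [primal_objective_eq]
  exact ((hP.f_strong i).add_linear _).exists_isArgmin (hP.h_pcc i)

theorem Assumptions.exists_d_eq (hP : P.Assumptions H) (w : BlockIdx m ⊕ BlockIdx p → ℝ) :
    ∃ r : ℝ, P.d w = r := by
  choose y hy using hP.exists_primal_argmin (P.fullCᵀ *ᵥ w)
  obtain ⟨r, h⟩ := hP.dual_bounds hy
  obtain ⟨dw, hdw, -⟩ := h w
  exact ⟨dw, hdw⟩

theorem Assumptions.D_ne_top (hP : P.Assumptions H) (w : BlockIdx m ⊕ BlockIdx p → ℝ) :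
    P.D w ≠ ⊤ := by
  obtain ⟨r, hr⟩ := hP.exists_d_eq w
  rw [D, hr]
  rcases eq_or_ne (P.gTilde w) ⊤ with h | h
  · simp [h]
  · obtain ⟨s, hs⟩ := exists_coe_of_ne (hP.gTilde_ne_bot w) h
    rw [hs, ← EReal.coe_sub]
    exact EReal.coe_ne_top _

theorem Assumptions.gTilde_eq_of_D_eq (hP : P.Assumptions H) {w : BlockIdx m ⊕ BlockIdx p → ℝ}
    {s dw : ℝ} (hs : P.D w = s) (hd : P.d w = dw) : P.gTilde w = ((dw - s : ℝ) : EReal) := by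
  have h : P.gTilde w ≠ ⊤ := fun h => by
    rw [D, h, EReal.sub_top] at hs
    exact EReal.coe_ne_bot _ hs.symm
  obtain ⟨q, hq⟩ := exists_coe_of_ne (hP.gTilde_ne_bot w) h
  rw [D, hd, hq, ← EReal.coe_sub, EReal.coe_eq_coe_iff] at hs
  rw [hq, ← hs, sub_sub_cancel]

/-- One iteration of the distributed method. -/
theorem Assumptions.dist_step (hP : P.Assumptions H)
    {Llam : ∀ i, Matrix (Fin (m i)) (Fin (m i)) ℝ} {Lmu : ∀ i, Matrix (Fin (p i)) (Fin (p i)) ℝ}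
    (hl : ∀ i, (Llam i).PosDef) (hm : ∀ i, (Lmu i).PosDef)
    (hL : (distL Llam Lmu - P.fullC * (Matrix.blockDiagonal' H)⁻¹ * P.fullCᵀ).PosSemidef)
    {z lam : ∀ i, Fin (m i) → ℝ} {v mu : ∀ i, Fin (p i) → ℝ} {y : ∀ i, Fin (n i) → ℝ}
    (hy : ∀ i, IsArgmin (fun x : Fin (n i) → ℝ => (P.f i x : EReal) + P.h i x +
      ((x ⬝ᵥ block (P.fullCᵀ *ᵥ Sum.elim (stack z) (stack v)) i : ℝ) : EReal)) (y i))
    (hlam : ∀ i, lam i = z i + (Llam i)⁻¹ *ᵥ (block (P.fullA *ᵥ stack y) i - P.b i))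
    (hmu : ∀ i, IsProx (conj (P.g i)) (Lmu i)
      (v i + (Lmu i)⁻¹ *ᵥ block (P.fullB *ᵥ stack y) i) (mu i)) :
    ∃ ρ : ℝ, P.D (Sum.elim (stack lam) (stack mu)) = ρ ∧
      ∀ (w : BlockIdx m ⊕ BlockIdx p → ℝ) (s : ℝ), P.D w = s →
        s + 1 / 2 * normSq (distL Llam Lmu) (w - Sum.elim (stack lam) (stack mu)) ≤
          ρ + 1 / 2 * normSq (distL Llam Lmu) (w - Sum.elim (stack z) (stack v)) := by
  obtain ⟨r, hd⟩ := hP.dual_bounds hy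
  have hprox := fun i => (hmu i).three_point (hP.g_pcc i).conj_properClosedConvex (hm i)
  choose q hq hprox using hprox
  set ν : BlockIdx m ⊕ BlockIdx p → ℝ := Sum.elim (stack lam) (stack mu) with hν
  obtain ⟨dν, hdν, -, hdν'⟩ := hd ν
  have hgν : P.gTilde ν = ((∑ i, q i : ℝ) : EReal) := by
    rw [hP.gTilde_eq, EReal.coe_finset_sum]
    exact Finset.sum_congr rfl fun i _ => hq i
  refine ⟨dν - ∑ i, q i, by rw [D, hdν, hgν, ← EReal.coe_sub], fun w s hs => ?_⟩
  obtain ⟨dw, hdw, hdw', -⟩ := hd w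
  have hgw := hP.gTilde_eq_of_D_eq hs hdw
  rw [hP.gTilde_eq] at hgw
  -- A finite sum with no summand `⊥` has no summand `⊤`.
  have hne : ∀ i, conj (P.g i) (block (fun a => w (Sum.inr a)) i) ≠ ⊤ := fun i hi => by
    rw [EReal.finset_sum_eq_top (fun j _ => (hP.g_pcc j).conj_properClosedConvex.ne_bot _)
      (Finset.mem_univ i) hi] at hgw
    exact EReal.coe_ne_top _ hgw.symm
  choose σ hσ using fun i =>
    exists_coe_of_ne ((hP.g_pcc i).conj_properClosedConvex.ne_bot _) (hne i)
  simp only [hσ] at hgw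
  rw [← EReal.coe_finset_sum, EReal.coe_eq_coe_iff] at hgw
  have h1 := Finset.sum_le_sum fun i (_ : i ∈ Finset.univ) => hprox i _ (σ i) (hσ i).le
  have h2 := Finset.sum_congr (rfl : (Finset.univ : Finset (Fin M)) = Finset.univ) fun i _ =>
    three_point_of_eq (hl i) (hlam i) (block (fun a => w (Sum.inl a)) i)
  simp only [Finset.sum_add_distrib, Finset.sum_sub_distrib, Finset.sum_neg_distrib,
    ← Finset.mul_sum] at h1 h2
  have hdot : ∀ (a : BlockIdx m ⊕ BlockIdx p → ℝ), a ⬝ᵥ (P.fullC *ᵥ stack y - P.fullc) =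
      ∑ i, block (fun c => a (Sum.inl c)) i ⬝ᵥ (block (P.fullA *ᵥ stack y) i - P.b i) +
      ∑ i, block (fun c => a (Sum.inr c)) i ⬝ᵥ block (P.fullB *ᵥ stack y) i := by
    intro a
    rw [fullC_mulVec_sub_fullc, ← dotProduct_eq_sum_block]
    have := dotProduct_eq_sum_block (fun c => a (Sum.inl c)) (P.fullA *ᵥ stack y - stack P.b)
    refine Eq.trans ?_ (congrArg (· + _) this)
    simp [dotProduct, Fintype.sum_sum_type]
  -- Here `L ⪰ C H⁻¹ Cᵀ` enters: the proximal term pays for the curvature of `d`.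
  have h3 := hL.normSq_nonneg (ν - Sum.elim (stack z) (stack v))
  have h4 : normSq (distL Llam Lmu - P.fullC * (Matrix.blockDiagonal' H)⁻¹ * P.fullCᵀ)
      (ν - Sum.elim (stack z) (stack v)) =
      normSq (distL Llam Lmu) (ν - Sum.elim (stack z) (stack v)) -
      normSq (P.fullC * (Matrix.blockDiagonal' H)⁻¹ * P.fullCᵀ)
        (ν - Sum.elim (stack z) (stack v)) := by
    simp only [normSq, Matrix.sub_mulVec, dotProduct_sub]
  rw [h4] at h3
  rw [hdot] at hdw' hdν'
  have n1 := normSq_distL Llam Lmu (ν - Sum.elim (stack z) (stack v))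
  have n2 := normSq_distL Llam Lmu (w - Sum.elim (stack z) (stack v))
  have n3 := normSq_distL Llam Lmu (w - ν)
  have k1 : ∀ i, block (fun c => ν (Sum.inl c)) i = lam i := fun _ => rfl
  have k2 : ∀ i, block (fun c => ν (Sum.inr c)) i = mu i := fun _ => rfl
  have k3 : ∀ i, block (fun c => (ν - Sum.elim (stack z) (stack v)) (Sum.inl c)) i =
    lam i - z i := fun _ => rfl
  have k4 : ∀ i, block (fun c => (ν - Sum.elim (stack z) (stack v)) (Sum.inr c)) i =
    mu i - v i := fun _ => rfl
  have k5 : ∀ i, block (fun c => (w - Sum.elim (stack z) (stack v)) (Sum.inl c)) i =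
    block (fun c => w (Sum.inl c)) i - z i := fun _ => rfl
  have k6 : ∀ i, block (fun c => (w - Sum.elim (stack z) (stack v)) (Sum.inr c)) i =
    block (fun c => w (Sum.inr c)) i - v i := fun _ => rfl
  have k7 : ∀ i, block (fun c => (w - ν) (Sum.inl c)) i =
    block (fun c => w (Sum.inl c)) i - lam i := fun _ => rfl
  have k8 : ∀ i, block (fun c => (w - ν) (Sum.inr c)) i =
    block (fun c => w (Sum.inr c)) i - mu i := fun _ => rfl
  simp only [k3, k4] at n1
  simp only [k5, k6] at n2
  simp only [k7, k8] at n3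
  simp only [k1, k2] at hdν'
  rw [n2, n3]
  rw [n1] at h3
  linarith

theorem gTilde_eq_zero (hg : ∀ i, P.g i = 0) (l : BlockIdx m → ℝ) :
    P.gTilde (Sum.elim l 0) = 0 := by
  have h0 : P.fullg = fun _ => 0 := by
    funext x
    simp [fullg, hg]
  simp [gTilde, conj, h0]

theorem gTilde_eq_top (hg : ∀ i, P.g i = 0) (l : BlockIdx m → ℝ) {u : BlockIdx p → ℝ}
    (hu : u ≠ 0) : P.gTilde (Sum.elim l u) = ⊤ := by
  have h0 : P.fullg = fun _ => 0 := by
    funext x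
    simp [fullg, hg]
  refine EReal.eq_top_iff_forall_lt _ |>.2 fun y => ?_
  have hpos : u ⬝ᵥ u ≠ 0 := fun h => hu (dotProduct_self_eq_zero.1 h)
  -- The multiple of `u` is scaled so that its pairing with `u` is `y + 1`.
  have := le_conj P.fullg u (((y + 1) / (u ⬝ᵥ u)) • u)
  rw [h0, dotProduct_smul, smul_eq_mul, div_mul_cancel₀ _ hpos, sub_zero] at this
  refine lt_of_lt_of_le (EReal.coe_lt_coe_iff.2 (lt_add_one y)) ?_
  simpa [gTilde, h0] using this

theorem D_sumElim_zero (hg : ∀ i, P.g i = 0) (l : BlockIdx m → ℝ) :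
    P.D (Sum.elim l 0) = P.d (Sum.elim l 0) := by
  rw [D, gTilde_eq_zero hg, sub_zero]

/-- One iteration of the parallel method. -/
theorem Assumptions.par_step (hP : P.Assumptions H) (hg : ∀ i, P.g i = 0)
    {L : Matrix (BlockIdx m) (BlockIdx m) ℝ} (hpos : L.PosDef)
    (hL : (L - P.fullA * (Matrix.blockDiagonal' H)⁻¹ * P.fullAᵀ).PosSemidef)
    {z lam : BlockIdx m → ℝ} {y : ∀ i, Fin (n i) → ℝ}
    (hy : ∀ i, IsArgmin (fun x : Fin (n i) → ℝ => (P.f i x : EReal) + P.h i x +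
      ((x ⬝ᵥ block (P.fullAᵀ *ᵥ z) i : ℝ) : EReal)) (y i))
    (hlam : lam = z + L⁻¹ *ᵥ (P.fullA *ᵥ stack y - stack P.b)) :
    ∃ ρ : ℝ, P.D (Sum.elim lam 0) = ρ ∧
      ∀ (w : BlockIdx m → ℝ) (s : ℝ), P.D (Sum.elim w 0) = s →
        s + 1 / 2 * normSq L (w - lam) ≤ ρ + 1 / 2 * normSq L (w - z) := by
  have hC : ∀ l : BlockIdx m → ℝ, P.fullCᵀ *ᵥ Sum.elim l 0 = P.fullAᵀ *ᵥ l := fun l => by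
    rw [fullC_transpose_mulVec, Matrix.mulVec_zero, add_zero]
  obtain ⟨r, hd⟩ := hP.dual_bounds (z := Sum.elim z 0) (y := y) (by simpa only [hC] using hy)
  have hdot : ∀ l : BlockIdx m → ℝ, Sum.elim l 0 ⬝ᵥ (P.fullC *ᵥ stack y - P.fullc) =
      l ⬝ᵥ (P.fullA *ᵥ stack y - stack P.b) := fun l => by
    rw [fullC_mulVec_sub_fullc]
    simp [dotProduct, Fintype.sum_sum_type]
  obtain ⟨dν, hdν, -, hdν'⟩ := hd (Sum.elim lam 0)
  refine ⟨dν, by rw [D_sumElim_zero hg, hdν], fun w s hs => ?_⟩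
  obtain ⟨dw, hdw, hdw', -⟩ := hd (Sum.elim w 0)
  rw [D_sumElim_zero hg, hdw, EReal.coe_eq_coe_iff] at hs
  have hsub : (Sum.elim lam 0 - Sum.elim z 0 : BlockIdx m ⊕ BlockIdx p → ℝ) =
      Sum.elim (lam - z) 0 := by
    funext a
    cases a <;> simp
  rw [hdot] at hdw' hdν'
  rw [normSq_mul_mul_transpose, hsub, hC, ← normSq_mul_mul_transpose] at hdν'
  have h1 := three_point_of_eq hpos hlam w
  have h2 := hL.normSq_nonneg (lam - z)
  have h3 : normSq (L - P.fullA * (Matrix.blockDiagonal' H)⁻¹ * P.fullAᵀ) (lam - z) =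
      normSq L (lam - z) - normSq (P.fullA * (Matrix.blockDiagonal' H)⁻¹ * P.fullAᵀ) (lam - z) := by
    simp only [normSq, Matrix.sub_mulVec, dotProduct_sub]
  rw [h3] at h2
  linarith

/-- The distributed method is well defined. -/
theorem Assumptions.exists_isDistRun (hP : P.Assumptions H)
    (Llam : ∀ i, Matrix (Fin (m i)) (Fin (m i)) ℝ) {Lmu : ∀ i, Matrix (Fin (p i)) (Fin (p i)) ℝ}
    (hm : ∀ i, (Lmu i).PosDef) (lam0 : ∀ i, Fin (m i) → ℝ) (mu0 : ∀ i, Fin (p i) → ℝ) :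
    ∃ S : DistIterates n m p, IsDistRun P Llam Lmu lam0 mu0 S := by
  choose Y hY using hP.exists_primal_argmin
  choose X hX using fun i => exists_isProx (hP.g_pcc i).conj_properClosedConvex (hm i)
  let y : (∀ i, Fin (m i) → ℝ) → (∀ i, Fin (p i) → ℝ) → ∀ i, Fin (n i) → ℝ := fun z v =>
    Y (P.fullAᵀ *ᵥ stack z + P.fullBᵀ *ᵥ stack v)
  let lam : (∀ i, Fin (m i) → ℝ) → (∀ i, Fin (p i) → ℝ) → ∀ i, Fin (m i) → ℝ := fun z v i =>
    z i + (Llam i)⁻¹ *ᵥ (∑ j ∈ P.rowNbrs i, P.A i j *ᵥ y z v j - P.b i)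
  let mu : (∀ i, Fin (m i) → ℝ) → (∀ i, Fin (p i) → ℝ) → ∀ i, Fin (p i) → ℝ := fun z v i =>
    X i (v i + (Lmu i)⁻¹ *ᵥ ∑ j ∈ P.rowNbrs i, P.B i j *ᵥ y z v j)
  let tn : ℝ → ℝ := fun t => (1 + √(1 + 4 * t ^ 2)) / 2
  let St := (((∀ i, Fin (m i) → ℝ) × (∀ i, Fin (p i) → ℝ)) ×
    ((∀ i, Fin (m i) → ℝ) × (∀ i, Fin (p i) → ℝ))) × ℝ
  let next : St → St := fun s =>
    (((fun i => lam s.1.1.1 s.1.1.2 i +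
          ((s.2 - 1) / tn s.2) • (lam s.1.1.1 s.1.1.2 i - s.1.2.1 i),
        fun i => mu s.1.1.1 s.1.1.2 i +
          ((s.2 - 1) / tn s.2) • (mu s.1.1.1 s.1.1.2 i - s.1.2.2 i)),
      (lam s.1.1.1 s.1.1.2, mu s.1.1.1 s.1.1.2)), tn s.2)
  -- State `k` holds `z^{k+1}, v^{k+1}`, then `λ^k, μ^k`, then `t^{k+1}`; hence the shifted index `k
  -- - 1` for `y`, `z`, `v`, `t` below.
  obtain ⟨st, h0, hs⟩ : ∃ st : ℕ → St, st 0 = (((lam0, mu0), (lam0, mu0)), 1) ∧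
      ∀ k, st (k + 1) = next (st k) :=
    ⟨fun k => Nat.rec (((lam0, mu0), (lam0, mu0)), 1) (fun _ s => next s) k, rfl, fun _ => rfl⟩
  refine ⟨⟨fun k => y (st (k - 1)).1.1.1 (st (k - 1)).1.1.2, fun k => (st (k - 1)).1.1.1,
    fun k => (st (k - 1)).1.1.2, fun k => (st k).1.2.1, fun k => (st k).1.2.2,
    fun k => (st (k - 1)).2⟩, ⟨by simp [h0], by simp [h0], by simp [h0], by simp [h0],
      by simp [h0], ?_, ?_, ?_, ?_, ?_, ?_⟩⟩ <;>
    (intro k hk; obtain ⟨k, rfl⟩ := Nat.exists_eq_add_of_le' hk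
     simp only [Nat.add_sub_cancel, hs])
  · intro i
    rw [sum_colNbrs_A, sum_colNbrs_B]
    exact hY (P.fullAᵀ *ᵥ stack (st k).1.1.1 + P.fullBᵀ *ᵥ stack (st k).1.1.2) i
  · exact fun i => rfl
  · exact fun i => hX i _
  · rfl
  · exact fun i => rfl
  · exact fun i => rfl

/-- The parallel method is well defined. -/
theorem Assumptions.exists_isParRun (hP : P.Assumptions H)
    (L : Matrix (BlockIdx m) (BlockIdx m) ℝ) (lam0 : BlockIdx m → ℝ) :
    ∃ S : ParIterates n m, IsParRun P L lam0 S := by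
  choose Y hY using hP.exists_primal_argmin
  let lam : (BlockIdx m → ℝ) → BlockIdx m → ℝ := fun z =>
    z + L⁻¹ *ᵥ (P.fullA *ᵥ stack (Y (P.fullAᵀ *ᵥ z)) - stack P.b)
  let tn : ℝ → ℝ := fun t => (1 + √(1 + 4 * t ^ 2)) / 2
  let St := ((BlockIdx m → ℝ) × (BlockIdx m → ℝ)) × ℝ
  let next : St → St := fun s =>
    ((lam s.1.1 + ((s.2 - 1) / tn s.2) • (lam s.1.1 - s.1.2), lam s.1.1), tn s.2)
  obtain ⟨st, h0, hs⟩ : ∃ st : ℕ → St, st 0 = ((lam0, lam0), 1) ∧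
      ∀ k, st (k + 1) = next (st k) :=
    ⟨fun k => Nat.rec ((lam0, lam0), 1) (fun _ s => next s) k, rfl, fun _ => rfl⟩
  refine ⟨⟨fun k => Y (P.fullAᵀ *ᵥ (st (k - 1)).1.1), fun k => (st (k - 1)).1.1,
    fun k => (st k).1.2, fun k => (st (k - 1)).2⟩, ⟨by simp [h0], by simp [h0], by simp [h0],
      ?_, ?_, ?_, ?_⟩⟩ <;>
    (intro k hk; obtain ⟨k, rfl⟩ := Nat.exists_eq_add_of_le' hk
     simp only [Nat.add_sub_cancel, hs])
  · intro i
    rw [sum_colNbrs_A]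
    exact hY _ i
  · rfl
  · rfl
  · rfl

theorem Assumptions.dist_rate (hP : P.Assumptions H)
    {Llam : ∀ i, Matrix (Fin (m i)) (Fin (m i)) ℝ} {Lmu : ∀ i, Matrix (Fin (p i)) (Fin (p i)) ℝ}
    (hl : ∀ i, (Llam i).PosDef) (hm : ∀ i, (Lmu i).PosDef)
    (hL : (distL Llam Lmu - P.fullC * (Matrix.blockDiagonal' H)⁻¹ * P.fullCᵀ).PosSemidef)
    {lam0 : ∀ i, Fin (m i) → ℝ} {mu0 : ∀ i, Fin (p i) → ℝ} {S : DistIterates n m p}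
    (hS : IsDistRun P Llam Lmu lam0 mu0 S) {νstar : BlockIdx m ⊕ BlockIdx p → ℝ}
    (hmax : IsArgmax P.D νstar) {k : ℕ} (hk : 1 ≤ k) :
    P.D νstar - P.D (Sum.elim (stack (S.lam k)) (stack (S.mu k))) ≤
      ((2 * normSq (distL Llam Lmu) (νstar - Sum.elim (stack lam0) (stack mu0)) /
        ((k : ℝ) + 1) ^ 2 : ℝ) : EReal) := by
  have h := accelerated_rate_ereal (isHermitian_distL hl hm)
    (fun x => by
      rw [normSq_distL]
      exact add_nonneg (Finset.sum_nonneg fun i _ => (hl i).posSemidef.normSq_nonneg _)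
        (Finset.sum_nonneg fun i _ => (hm i).posSemidef.normSq_nonneg _))
    (x := fun k => Sum.elim (stack (S.lam k)) (stack (S.mu k)))
    (z := fun k => Sum.elim (stack (S.z k)) (stack (S.v k)))
    hP.D_ne_top hmax (by simp only [hS.z_one, hS.v_one, hS.lam_zero, hS.mu_zero])
    hS.t_one hS.t_step
    (fun k hk => by
      funext a
      rcases a with ⟨i, a⟩ | ⟨i, a⟩
      · exact congrFun (hS.z_step k hk i) a
      · exact congrFun (hS.v_step k hk i) a)
    (fun k hk => hP.dist_step hl hm hL (y := S.y k)
      (fun i => by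
        have := hS.y_step k hk i
        rw [sum_colNbrs_A, sum_colNbrs_B] at this
        rw [fullC_transpose_mulVec]
        exact this)
      (fun i => by rw [hS.lam_step k hk i, sum_rowNbrs_A])
      (fun i => by
        have := hS.mu_step k hk i
        rwa [sum_rowNbrs_B] at this)) hk
  rwa [hS.lam_zero, hS.mu_zero] at h

theorem Assumptions.par_rate (hP : P.Assumptions H) (hg : ∀ i, P.g i = 0)
    {L : Matrix (BlockIdx m) (BlockIdx m) ℝ} (hpos : L.PosDef)
    (hL : (L - P.fullA * (Matrix.blockDiagonal' H)⁻¹ * P.fullAᵀ).PosSemidef)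
    {lam0 : BlockIdx m → ℝ} {S : ParIterates n m} (hS : IsParRun P L lam0 S)
    {lamstar : BlockIdx m → ℝ} {mustar : BlockIdx p → ℝ}
    (hmax : IsArgmax P.D (Sum.elim lamstar mustar)) {k : ℕ} (hk : 1 ≤ k) :
    P.D (Sum.elim lamstar mustar) - P.D (Sum.elim (S.lam k) 0) ≤
      ((2 * normSq L (lamstar - lam0) / ((k : ℝ) + 1) ^ 2 : ℝ) : EReal) := by
  -- For `μ ≠ 0` the dual value is `⊥`, while it is real at `(λ⁰, 0)`; so the problem reduces to `λ`
  -- alone.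
  have hmu : mustar = 0 := by
    by_contra hne
    have := hmax (Sum.elim lam0 0)
    obtain ⟨r, hr⟩ := hP.exists_d_eq (Sum.elim lam0 0)
    rw [D_sumElim_zero hg, hr, D, gTilde_eq_top hg _ hne, EReal.sub_top, le_bot_iff] at this
    exact EReal.coe_ne_bot _ this
  subst hmu
  have h := accelerated_rate_ereal hpos.isHermitian hpos.posSemidef.normSq_nonneg
    (Φ := fun l => P.D (Sum.elim l 0)) (x := S.lam) (z := S.z) (fun _ => hP.D_ne_top _)
    (fun l => hmax _) (by rw [hS.z_one, hS.lam_zero]) hS.t_one hS.t_step hS.z_step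
    (fun k hk => hP.par_step hg hpos hL (y := S.y k)
      (fun i => by
        have := hS.y_step k hk i
        rwa [sum_colNbrs_A] at this)
      (hS.lam_step k hk)) hk
  rwa [hS.lam_zero] at h

end Problem

theorem mainTheorem4 {M : ℕ} {n m p : Fin M → ℕ} (P : Problem M n m p)
    (H : ∀ i, Matrix (Fin (n i)) (Fin (n i)) ℝ) (hP : P.Assumptions H) :
    -- the distributed method
    (∀ (Llam : ∀ i, Matrix (Fin (m i)) (Fin (m i)) ℝ)
        (Lmu : ∀ i, Matrix (Fin (p i)) (Fin (p i)) ℝ),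
      (∀ i, (Llam i).PosDef) → (∀ i, (Lmu i).PosDef) →
      (distL Llam Lmu - P.fullC * (Matrix.blockDiagonal' H)⁻¹ * P.fullCᵀ).PosSemidef →
      ∀ (lam0 : ∀ i, Fin (m i) → ℝ) (mu0 : ∀ i, Fin (p i) → ℝ),
        (∃ S : DistIterates n m p, IsDistRun P Llam Lmu lam0 mu0 S) ∧
        ∀ S : DistIterates n m p, IsDistRun P Llam Lmu lam0 mu0 S →
          ∀ νstar : BlockIdx m ⊕ BlockIdx p → ℝ, IsArgmax P.D νstar →
            ∀ k : ℕ, 1 ≤ k →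
              P.D νstar - P.D (Sum.elim (stack (S.lam k)) (stack (S.mu k))) ≤
                ((2 * normSq (distL Llam Lmu)
                    (νstar - Sum.elim (stack lam0) (stack mu0)) / ((k : ℝ) + 1) ^ 2 : ℝ) :
                  EReal)) ∧
    -- the parallel method, for problems without the term `g`
    ((∀ i, P.g i = 0) →
      ∀ L : Matrix (BlockIdx m) (BlockIdx m) ℝ, L.PosDef →
      (L - P.fullA * (Matrix.blockDiagonal' H)⁻¹ * P.fullAᵀ).PosSemidef →
      ∀ lam0 : BlockIdx m → ℝ,
        (∃ S : ParIterates n m, IsParRun P L lam0 S) ∧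
        ∀ S : ParIterates n m, IsParRun P L lam0 S →
          ∀ (lamstar : BlockIdx m → ℝ) (mustar : BlockIdx p → ℝ),
            IsArgmax P.D (Sum.elim lamstar mustar) →
            ∀ k : ℕ, 1 ≤ k →
              P.D (Sum.elim lamstar mustar) - P.D (Sum.elim (S.lam k) 0) ≤
                ((2 * normSq L (lamstar - lam0) / ((k : ℝ) + 1) ^ 2 : ℝ) : EReal)) := by
  refine ⟨fun Llam Lmu hl hm hL lam0 mu0 => ⟨hP.exists_isDistRun Llam hm lam0 mu0,
      fun S hS νstar hmax k hk => hP.dist_rate hl hm hL hS hmax hk⟩,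
    fun hg L hpos hL lam0 => ⟨hP.exists_isParRun L lam0,
      fun S hS lamstar mustar hmax k hk => hP.par_rate hg hpos hL hS hmax hk⟩⟩
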